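/- A geometric graph is a finite simple graph $G=(V,E)$ whose vertices are distinct points of the plane and whose edges are drawn as straight line segments. Two distinct edges cross if the relative interiors of their segments intersect, and $\mathrm{cr}(G)$ is the number of unordered pairs of edges of $G$ that cross. The model of computation is the real RAM: integer memory cells hold machine words of $O(\log n)$ bits, real memory cells hold real numbers, and each arithmetic operation, comparison and (indirectly addressed) memory access costs one step. The input consists of the number $n=|V|$, the adjacency matrix of $G$ and the coordinates of the vertices; time bounds of the form $O(n^2)$ mean at most $C(n^2+1)$ steps for an absolute constant $C$. (a) A convex geometric graph is a geometric graph whose vertices are in convex position, i.e. no vertex lies in the convex hull of the other vertices. There is an algorithm that computes $\mathrm{cr}(G)$ in $O(n^2)$ time for every convex geometric graph $G$ on $n$ vertices. Moreover, if $G=(V,E)$ is a convex geometric graph and $u\in V$, then there are two open rays with apex $u$ and opposite directions that are disjoint from the convex hull of $V$; in particular, no edge of $G$ meets either of the two rays. (b) A layered graph is a geometric graph whose vertex set is partitioned into layers $L_1,\dots,L_r$ such that all vertices of $L_i$ have the same $y$-coordinate $y_i$, $y_1<y_2<\dots<y_r$, and vertices of $L_i$ are adjacent only to vertices of $L_{i-1}$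 and $L_{i+1}$ (vertices of one layer may be collinear). There is an algorithm that computes $\mathrm{cr}(G)$ in $O(n^2)$ time for every layered graph $G$ on $n$ vertices. Consequently, the same algorithm computes $\mathrm{cr}(G)$ in $o(|E|\log|V|)$ time on layered graphs with $\omega(n^2/\log n)$ edges: if $f:\mathbb N\to\mathbb N$ satisfies $n^2/\log n=o(f(n))$, then for every $\varepsilon>0$ there is $n_0$ such that for every $n\ge n_0$ and every layered graph $G$ with $n$ vertices and $|E|\ge f(n)$ the algorithm takes at most $\varepsilon\,|E|\log n$ steps. (c) Let $G$ be a layered graph with layers $L_1,\dots,L_r$ and, for $1\le i\le r-1$, let $G_i$ be the subgraph of $G$ induced by $L_i\cup L_{i+1}$. Then $\mathrm{cr}(G)=\sum_{i=1}^{r-1}\mathrm{cr}(G_i)$. Moreover, for every $i$ and every $\varepsilon>0$ the vertices of $G_i$ can be moved, each by less than $\varepsilon$, to points in convex position in such a way that two edges of $G_i$ cross after the move if and only if they cross before it. -/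

import Mathlib

/-! ### Geometric graphs: a simple graph `G` together with the positions `pos` of its vertices -/

/-- The relative interior of the straight line segment that joins the endpoints of `e`. -/
def edgeInterior {V : Type*} (pos : V → ℝ × ℝ) : Sym2 V → Set (ℝ × ℝ) :=
  Sym2.lift ⟨fun u v => openSegment ℝ (pos u) (pos v), fun _ _ => openSegment_symm ℝ _ _⟩

/-- The closed straight line segment that joins the endpoints of `e`. -/
def edgeSegment {V : Type*} (pos : V → ℝ × ℝ) : Sym2 V → Set (ℝ × ℝ) :=
  Sym2.lift ⟨fun u v => segment ℝ (pos u) (pos v), fun _ _ => segment_symm ℝ _ _⟩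

/-- Two edges cross if they intersect in their interiors. -/
def EdgesCross {V : Type*} (pos : V → ℝ × ℝ) (e f : Sym2 V) : Prop :=
  (edgeInterior pos e ∩ edgeInterior pos f).Nonempty

/-- The number of crossings: the number of unordered pairs of distinct edges that cross. -/
noncomputable def numCrossings {V : Type*} (G : SimpleGraph V) (pos : V → ℝ × ℝ) : ℕ :=
  Set.ncard {p : Sym2 (Sym2 V) | ∃ e f : Sym2 V, p = s(e, f) ∧
    e ∈ G.edgeSet ∧ f ∈ G.edgeSet ∧ e ≠ f ∧ EdgesCross pos e f}

/-- The open ray with apex `p` and direction `d`. -/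
def openRay (p d : ℝ × ℝ) : Set (ℝ × ℝ) := {q | ∃ t : ℝ, 0 < t ∧ q = p + t • d}

/-- The number of edges of the geometric graph that meet the open ray with apex `p` and
direction `d`. -/
noncomputable def rayCount {V : Type*} (G : SimpleGraph V) (pos : V → ℝ × ℝ) (p d : ℝ × ℝ) : ℕ :=
  Set.ncard {e : Sym2 V | e ∈ G.edgeSet ∧ (openRay p d ∩ edgeSegment pos e).Nonempty}

/-- `layer` assigns to each vertex the index of its layer; layer `i` lies on the horizontal line of
height `y i`, heights increase strictly with the index, and edges join consecutive layers only. -/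
structure IsLayering {V : Type*} (G : SimpleGraph V) (pos : V → ℝ × ℝ) {r : ℕ}
    (layer : V → Fin r) (y : Fin r → ℝ) : Prop where
  injective : Function.Injective pos
  strictMono : StrictMono y
  height : ∀ v, (pos v).2 = y (layer v)
  adj : ∀ u v, G.Adj u v →
    (layer u : ℕ) + 1 = (layer v : ℕ) ∨ (layer v : ℕ) + 1 = (layer u : ℕ)

/-- A layered (geometric) graph. -/
def IsLayered {V : Type*} (G : SimpleGraph V) (pos : V → ℝ × ℝ) : Prop :=
  ∃ (r : ℕ) (layer : V → Fin r) (y : Fin r → ℝ), IsLayering G pos layer y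

/-- The vertices in layers `i` and `i + 1` (layers are numbered from `0`). -/
def bilayer {V : Type*} {r : ℕ} (layer : V → Fin r) (i : ℕ) : Set V :=
  {v | (layer v : ℕ) = i ∨ (layer v : ℕ) = i + 1}

/-- The bilayer subgraph: the subgraph induced by layers `i` and `i + 1`. -/
def bilayerGraph {V : Type*} (G : SimpleGraph V) {r : ℕ} (layer : V → Fin r) (i : ℕ) :
    SimpleGraph (bilayer layer i) :=
  G.induce (bilayer layer i)

/-- The positions of the vertices of the bilayer subgraph. -/
def bilayerPos {V : Type*} (pos : V → ℝ × ℝ) {r : ℕ} (layer : V → Fin r) (i : ℕ) :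
    bilayer layer i → ℝ × ℝ :=
  fun v => pos v

/-! ### The machine model: a real RAM

A random access machine with integer memory (natural numbers that fit in a machine word) and real
memory.  Memory is organised in registers and in one-dimensional arrays; a program mentions only
finitely many of them, by fixed names, while array positions are computed at run time (indirect
addressing).  On integers the operations are `+`, truncated `-`, `*` and comparison, on reals they
are `+`, `-`, `*` and comparison; there is no division, no root, no rounding, and no conversion from
reals to integers.  Every operation, memory access and test costs one step. -/

/-- Memory contents. -/
structure RamState where
  /-- integer registers -/
  reg : ℕ → ℕ
  /-- integer arrays: name, then position -/
  iarr : ℕ → ℕ → ℕ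
  /-- real arrays: name, then position -/
  rarr : ℕ → ℕ → ℝ

/-- Integer expressions. -/
inductive IntExpr where
  | const (z : ℕ)
  | reg (x : ℕ)
  | load (a : ℕ) (i : IntExpr)
  | add (e₁ e₂ : IntExpr)
  | sub (e₁ e₂ : IntExpr)
  | mul (e₁ e₂ : IntExpr)

/-- Value of an integer expression. -/
def IntExpr.eval (s : RamState) : IntExpr → ℕ
  | .const z => z
  | .reg x => s.reg x
  | .load a i => s.iarr a (i.eval s)
  | .add e₁ e₂ => e₁.eval s + e₂.eval s
  | .sub e₁ e₂ => e₁.eval s - e₂.eval s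
  | .mul e₁ e₂ => e₁.eval s * e₂.eval s

/-- Number of steps taken to evaluate an integer expression. -/
def IntExpr.cost : IntExpr → ℕ
  | .const _ => 1
  | .reg _ => 1
  | .load _ i => i.cost + 1
  | .add e₁ e₂ => e₁.cost + e₂.cost + 1
  | .sub e₁ e₂ => e₁.cost + e₂.cost + 1
  | .mul e₁ e₂ => e₁.cost + e₂.cost + 1

/-- Real expressions. -/
inductive RealExpr where
  | const (z : ℤ)
  | load (a : ℕ) (i : IntExpr)
  | add (e₁ e₂ : RealExpr)
  | sub (e₁ e₂ : RealExpr)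
  | mul (e₁ e₂ : RealExpr)

/-- Value of a real expression. -/
noncomputable def RealExpr.eval (s : RamState) : RealExpr → ℝ
  | .const z => (z : ℝ)
  | .load a i => s.rarr a (i.eval s)
  | .add e₁ e₂ => e₁.eval s + e₂.eval s
  | .sub e₁ e₂ => e₁.eval s - e₂.eval s
  | .mul e₁ e₂ => e₁.eval s * e₂.eval s

/-- Number of steps taken to evaluate a real expression. -/
def RealExpr.cost : RealExpr → ℕ
  | .const _ => 1
  | .load _ i => i.cost + 1
  | .add e₁ e₂ => e₁.cost + e₂.cost + 1
  | .sub e₁ e₂ => e₁.cost + e₂.cost + 1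
  | .mul e₁ e₂ => e₁.cost + e₂.cost + 1

/-- Tests. -/
inductive RamTest where
  | intLt (e₁ e₂ : IntExpr)
  | realLt (e₁ e₂ : RealExpr)
  | not (b : RamTest)
  | and (b₁ b₂ : RamTest)

/-- Outcome of a test. -/
def RamTest.Holds (s : RamState) : RamTest → Prop
  | .intLt e₁ e₂ => e₁.eval s < e₂.eval s
  | .realLt e₁ e₂ => e₁.eval s < e₂.eval s
  | .not b => ¬ b.Holds s
  | .and b₁ b₂ => b₁.Holds s ∧ b₂.Holds s

/-- Number of steps taken by a test. -/
def RamTest.cost : RamTest → ℕ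
  | .intLt e₁ e₂ => e₁.cost + e₂.cost + 1
  | .realLt e₁ e₂ => e₁.cost + e₂.cost + 1
  | .not b => b.cost + 1
  | .and b₁ b₂ => b₁.cost + b₂.cost + 1

/-- Programs. -/
inductive RamProgram where
  | skip
  | setReg (x : ℕ) (e : IntExpr)
  | storeInt (a : ℕ) (i e : IntExpr)
  | storeReal (a : ℕ) (i : IntExpr) (e : RealExpr)
  | seq (c d : RamProgram)
  | branch (b : RamTest) (c d : RamProgram)
  | loop (b : RamTest) (c : RamProgram)

/-- `RamExec W c s t s'`: on a machine whose integer memory cells hold only numbers up to `W`,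
the program `c`, started in `s`, halts in `s'` after exactly `t` steps.  Storing an integer
larger than `W` is a fault: the execution has no final state. -/
inductive RamExec (W : ℕ) : RamProgram → RamState → ℕ → RamState → Prop where
  | skip (s : RamState) : RamExec W .skip s 1 s
  | setReg (s : RamState) (x : ℕ) (e : IntExpr) (h : e.eval s ≤ W) :
      RamExec W (.setReg x e) s (e.cost + 1)
        { s with reg := Function.update s.reg x (e.eval s) }
  | storeInt (s : RamState) (a : ℕ) (i e : IntExpr) (h : e.eval s ≤ W) :
      RamExec W (.storeInt a i e) s (i.cost + e.cost + 1)
        { s with iarr :=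
            Function.update s.iarr a (Function.update (s.iarr a) (i.eval s) (e.eval s)) }
  | storeReal (s : RamState) (a : ℕ) (i : IntExpr) (e : RealExpr) :
      RamExec W (.storeReal a i e) s (i.cost + e.cost + 1)
        { s with rarr :=
            Function.update s.rarr a (Function.update (s.rarr a) (i.eval s) (e.eval s)) }
  | seq {c d : RamProgram} {s s' s'' : RamState} {t t' : ℕ}
      (hc : RamExec W c s t s') (hd : RamExec W d s' t' s'') :
      RamExec W (.seq c d) s (t + t') s''
  | branchTrue {b : RamTest} {c d : RamProgram} {s s' : RamState} {t : ℕ}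
      (hb : b.Holds s) (hc : RamExec W c s t s') :
      RamExec W (.branch b c d) s (b.cost + t) s'
  | branchFalse {b : RamTest} {c d : RamProgram} {s s' : RamState} {t : ℕ}
      (hb : ¬ b.Holds s) (hd : RamExec W d s t s') :
      RamExec W (.branch b c d) s (b.cost + t) s'
  | loopDone {b : RamTest} {c : RamProgram} {s : RamState} (hb : ¬ b.Holds s) :
      RamExec W (.loop b c) s b.cost s
  | loopStep {b : RamTest} {c : RamProgram} {s s' s'' : RamState} {t t' : ℕ}
      (hb : b.Holds s) (hc : RamExec W c s t s') (hl : RamExec W (.loop b c) s' t' s'') :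
      RamExec W (.loop b c) s (b.cost + t + t') s''

open Classical in
/-- The input: register `0` holds `n`, integer array `0` holds the adjacency matrix row by row,
real arrays `0` and `1` hold the `x`- and the `y`-coordinates of the vertices, and everything else
is `0`. -/
noncomputable def ramInput {n : ℕ} (G : SimpleGraph (Fin n)) (pos : Fin n → ℝ × ℝ) : RamState where
  reg := fun x => if x = 0 then n else 0
  iarr := fun a p =>
    if a = 0 ∧ ∃ i j : Fin n, p = (i : ℕ) * n + (j : ℕ) ∧ G.Adj i j then 1 else 0
  rarr := fun a p =>
    if h : p < n then
      if a = 0 then (pos ⟨p, h⟩).1 else if a = 1 then (pos ⟨p, h⟩).2 else 0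
    else 0

/-- On the geometric graph `(G, pos)` with `n` vertices, the program `P` halts after exactly `t`
steps with the number of crossings in register `1`.  All stored integers are at most `(n + 2) ^ k`,
that is, for fixed `k` machine words have `O(log n)` bits. -/
def CountsCrossingsIn (P : RamProgram) (k : ℕ) {n : ℕ} (G : SimpleGraph (Fin n))
    (pos : Fin n → ℝ × ℝ) (t : ℕ) : Prop :=
  ∃ s : RamState, RamExec ((n + 2) ^ k) P (ramInput G pos) t s ∧ s.reg 1 = numCrossings G pos

/-! Both algorithms are instances of one counting scheme. Fix a linear order `e` of the vertices and
direct every edge from its smaller to its larger endpoint. In both classes, edges ab and cd with a <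
c cross exactly when c < b and b precedes d in a second order, given by a permutation `τ` of the
ranks; edges with a common smaller endpoint never cross. In convex position `e` is the
counterclockwise order from vertex 0 and `τ` is the identity: chords cross iff their ends alternate,
a < c < b < d. In a layered graph `e` goes by height, then from left to right, and `τ` is the
reversal: edges cross iff they span the same strip and their lower and upper ends are oppositely
ordered.

Such pairs are counted in quadratic time. For each rank k, in the role of c, the ranks l > k are
visited in the order `τ`; an array keeps the number of edges into l from below k, a register the sum
of these numbers over the ranks visited so far, and an edge kl contributes that sum. Ranks come from
counting predecessors, so no sorting is needed. `rankProgram_runs` and `sumProgram_runs` verify the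
two phases, `numCrossings_eq_card` and `sum_rowPairs_eq_card` identify the result with the number of
crossings, and `countProgram_counts` combines them. Geometry enters the crossing criteria through
signs of `orient`, by `openSegment_inter_nonempty_iff`.

The rays at u lie on a line through u parallel to one that strictly separates u from the hull of the
other vertices. Crossing edges of a layered graph lie in the same strip, which gives the sum over
bilayers. Two layers become convex by bending their lines into flat parabolas, the lower opening
upwards and the upper downwards, so flat that no nonzero orientation changes sign
(`exists_convex_perturbation`). -/

/-! ### Orientations -/

/-- Twice the signed area of the triangle `a b c`. -/
def orient (a b c : ℝ × ℝ) : ℝ := (b.1 - a.1) * (c.2 - a.2) - (b.2 - a.2) * (c.1 - a.1)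

theorem orient_rotate (a b c : ℝ × ℝ) : orient b c a = orient a b c := by
  unfold orient; ring

theorem orient_swap (a b c : ℝ × ℝ) : orient a c b = -orient a b c := by
  unfold orient; ring

theorem orient_self_right (a b : ℝ × ℝ) : orient a b b = 0 := by
  unfold orient; ring

theorem orient_self_outer (a b : ℝ × ℝ) : orient a b a = 0 := by
  unfold orient; ring

theorem ne_of_orient_pos {V : Type*} {pos : V → ℝ × ℝ} {a b c : V}
    (h : 0 < orient (pos a) (pos b) (pos c)) : a ≠ b ∧ a ≠ c ∧ b ≠ c := by
  refine ⟨?_, ?_, ?_⟩ <;> rintro rfl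
  · simp [orient] at h
  · simp [orient_self_outer] at h
  · simp [orient_self_right] at h

theorem orient_combo (a b c d : ℝ × ℝ) {s t : ℝ} (h : s + t = 1) :
    orient a b (s • c + t • d) = s * orient a b c + t * orient a b d := by
  obtain rfl : s = 1 - t := by linarith
  simp only [orient, Prod.fst_add, Prod.snd_add, Prod.smul_fst, Prod.smul_snd, smul_eq_mul]
  ring

theorem mul_neg_of_combo_eq_zero {s t x y : ℝ} (hs : 0 < s) (ht : 0 < t)
    (h : s * x + t * y = 0) (hxy : x ≠ 0 ∨ y ≠ 0) : x * y < 0 := by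
  have hy : y ≠ 0 := by
    rintro rfl
    rcases hxy with hx | hy
    · apply hx
      have : s * x = 0 := by linarith
      exact (mul_eq_zero.mp this).resolve_left hs.ne'
    · exact hy rfl
  have h1 : s * (x * y) = -(t * (y * y)) := by linear_combination y * h
  have h2 : 0 < t * (y * y) := mul_pos ht (mul_self_pos.mpr hy)
  by_contra hc
  have := mul_nonneg hs.le (not_lt.mp hc)
  linarith

theorem orient_eq_zero_of_mem_openSegment {a b p : ℝ × ℝ} (h : p ∈ openSegment ℝ a b) :
    orient a b p = 0 := by
  obtain ⟨s, t, -, -, hst, rfl⟩ := h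
  rw [orient_combo a b a b hst, orient_self_outer, orient_self_right]
  ring

/-- `orient a b` is affine along cd and vanishes at a common point, so its values at c and d have
opposite signs; likewise with the segments exchanged. The hypotheses exclude four collinear points,
where open segments may overlap although all orientations vanish. -/
theorem openSegment_inter_nonempty_iff {a b c d : ℝ × ℝ}
    (h1 : orient a b c ≠ 0 ∨ orient a b d ≠ 0) (h2 : orient c d a ≠ 0 ∨ orient c d b ≠ 0) :
    (openSegment ℝ a b ∩ openSegment ℝ c d).Nonempty ↔
      orient a b c * orient a b d < 0 ∧ orient c d a * orient c d b < 0 := by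
  constructor
  · rintro ⟨p, hp, hq⟩
    have e1 := orient_eq_zero_of_mem_openSegment hp
    have e2 := orient_eq_zero_of_mem_openSegment hq
    obtain ⟨s, s', hs, hs', hss, rfl⟩ := hp
    obtain ⟨t, t', ht, ht', htt, hpt⟩ := hq
    rw [orient_combo _ _ _ _ hss] at e2
    rw [← hpt, orient_combo _ _ _ _ htt] at e1
    exact ⟨mul_neg_of_combo_eq_zero ht ht' e1 h1, mul_neg_of_combo_eq_zero hs hs' e2 h2⟩
  · rintro ⟨hX, hU⟩
    -- Both sides are the cross product of d - c and b - a, the common denominator in Cramer's rule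
    -- for the intersection point.
    have hD : orient c d b - orient c d a = orient a b c - orient a b d := by
      unfold orient; ring
    have hD0 : orient c d b - orient c d a ≠ 0 := by
      intro h
      have : orient c d b = orient c d a := by linarith
      rw [this] at hU
      exact absurd hU (not_lt.mpr (mul_self_nonneg _))
    have key : ∀ x y : ℝ, x * y < 0 → 0 < y / (y - x) ∧ 0 < -x / (y - x) := by
      intro x y h
      rcases mul_neg_iff.mp h with ⟨hx, hy⟩ | ⟨hx, hy⟩
      · exact ⟨div_pos_of_neg_of_neg hy (by linarith),
          div_pos_of_neg_of_neg (by linarith) (by linarith)⟩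
      · exact ⟨div_pos hy (by linarith), div_pos (by linarith) (by linarith)⟩
    obtain ⟨p1, p2⟩ := key _ _ hU
    obtain ⟨q1, q2⟩ := key (orient a b d) (orient a b c) (by rwa [mul_comm])
    rw [← hD] at q1 q2
    refine ⟨_, ⟨_, _, p1, p2, ?_, rfl⟩, ⟨_, _, q2, q1, ?_, ?_⟩⟩
    · field_simp; ring
    · field_simp; linarith
    · ext
      · simp only [Prod.fst_add, Prod.smul_fst, smul_eq_mul]
        field_simp
        unfold orient; ring
      · simp only [Prod.snd_add, Prod.smul_snd, smul_eq_mul]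
        field_simp
        unfold orient; ring

/-! ### Crossing as a relation between edges -/

theorem edgesCross_mk {V : Type*} (pos : V → ℝ × ℝ) (a b c d : V) :
    EdgesCross pos s(a, b) s(c, d) ↔
      (openSegment ℝ (pos a) (pos b) ∩ openSegment ℝ (pos c) (pos d)).Nonempty := Iff.rfl

theorem EdgesCross.symm {V : Type*} {pos : V → ℝ × ℝ} {e f : Sym2 V} (h : EdgesCross pos e f) :
    EdgesCross pos f e := by
  unfold EdgesCross at *
  rwa [Set.inter_comm]

theorem edgesCross_self {V : Type*} (pos : V → ℝ × ℝ) (e : Sym2 V) : EdgesCross pos e e := by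
  induction e with
  | h a b =>
    rw [edgesCross_mk, Set.inter_self]
    exact ⟨_, 1 / 2, 1 / 2, by norm_num, by norm_num, by norm_num, rfl⟩

/-! ### Points in convex position -/

/-- The barycentric coordinates of p are ratios of signed areas. -/
theorem mem_convexHull_of_orient {a b c p : ℝ × ℝ} (h : 0 < orient a b c)
    (h1 : 0 ≤ orient a b p) (h2 : 0 ≤ orient b c p) (h3 : 0 ≤ orient c a p) :
    p ∈ convexHull ℝ {a, b, c} := by
  have hp : p = (orient b c p / orient a b c) • a + (orient c a p / orient a b c) • b +
      (orient a b p / orient a b c) • c := by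
    have h0 := h.ne'
    ext
    · simp only [Prod.fst_add, Prod.smul_fst, smul_eq_mul]
      field_simp
      unfold orient; ring
    · simp only [Prod.snd_add, Prod.smul_snd, smul_eq_mul]
      field_simp
      unfold orient; ring
  rw [hp]
  have hs : orient b c p / orient a b c + orient c a p / orient a b c +
      orient a b p / orient a b c = 1 := by
    have h0 := h.ne'
    field_simp
    unfold orient; ring
  have m := (convex_convexHull ℝ {a, b, c}).sum_mem (t := (Finset.univ : Finset (Fin 3)))
    (w := ![orient b c p / orient a b c, orient c a p / orient a b c,
      orient a b p / orient a b c]) (z := ![a, b, c]) (by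
        intro i _
        fin_cases i <;> simp <;> positivity) (by
        simpa [Fin.sum_univ_three] using hs) (by
        intro i _
        apply subset_convexHull
        fin_cases i <;> simp)
  rw [Fin.sum_univ_three] at m
  exact m

theorem orient_eq_zero_wbtw {a b c : ℝ × ℝ} (h : orient a b c = 0) :
    c ∈ segment ℝ a b ∨ a ∈ segment ℝ b c ∨ b ∈ segment ℝ c a := by
  have hcol : Collinear ℝ {a, b, c} := by
    by_cases hab : a = b
    · subst hab
      simpa using collinear_pair ℝ a c
    rw [collinear_iff_of_mem (p₀ := a) (by simp)]
    refine ⟨b - a, ?_⟩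
    intro p hp
    simp only [Set.mem_insert_iff, Set.mem_singleton_iff] at hp
    rcases hp with rfl | rfl | rfl
    · exact ⟨0, by simp⟩
    · exact ⟨1, by simp⟩
    · by_cases hx : b.1 - a.1 = 0
      · have hy : b.2 - a.2 ≠ 0 := by
          intro hy
          exact hab (Prod.ext (by linarith) (by linarith))
        refine ⟨(p.2 - a.2) / (b.2 - a.2), ?_⟩
        unfold orient at h
        rw [hx] at h
        have : p.1 - a.1 = 0 := by
          have : (b.2 - a.2) * (p.1 - a.1) = 0 := by linarith
          exact (mul_eq_zero.mp this).resolve_left hy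
        ext
        · simp [hx]; linarith
        · simp; field_simp; ring
      · refine ⟨(p.1 - a.1) / (b.1 - a.1), ?_⟩
        unfold orient at h
        ext
        · simp; field_simp; ring
        · simp; field_simp; linarith
  rcases hcol.wbtw_or_wbtw_or_wbtw with h | h | h
  · exact Or.inr (Or.inr (by rw [segment_symm]; exact h.mem_segment))
  · exact Or.inl (by rw [segment_symm]; exact h.mem_segment)
  · exact Or.inr (Or.inl (by rw [segment_symm]; exact h.mem_segment))

theorem ConvexIndependent.mem_of_mem_convexHull {V : Type*} {pos : V → ℝ × ℝ}
    (h : ConvexIndependent ℝ pos) {s : Set V} {x : V} {t : Set (ℝ × ℝ)}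
    (hx : pos x ∈ convexHull ℝ t) (ht : t = pos '' s) : x ∈ s :=
  h s x (ht ▸ hx)

/-- Of three collinear points one lies on the segment joining the other two, which convex position
forbids. -/
theorem ConvexIndependent.orient_ne_zero {V : Type*} {pos : V → ℝ × ℝ}
    (h : ConvexIndependent ℝ pos) {u v w : V} (huv : u ≠ v) (huw : u ≠ w) (hvw : v ≠ w) :
    orient (pos u) (pos v) (pos w) ≠ 0 := by
  intro h0
  have key : ∀ a b c : V, pos c ∈ segment ℝ (pos a) (pos b) → c = a ∨ c = b := by
    intro a b c hc
    rw [← convexHull_pair] at hc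
    simpa using h.mem_of_mem_convexHull (s := {a, b}) hc (by rw [Set.image_pair])
  rcases orient_eq_zero_wbtw h0 with h1 | h1 | h1 <;> rcases key _ _ _ h1 with e | e <;> grind

/-- Otherwise p would lie in the triangle abc. -/
theorem ConvexIndependent.orient_neg {V : Type*} {pos : V → ℝ × ℝ}
    (h : ConvexIndependent ℝ pos) {a b c p : V} (hpa : p ≠ a) (hpb : p ≠ b) (hpc : p ≠ c)
    (h0 : 0 < orient (pos a) (pos b) (pos c)) (h1 : 0 ≤ orient (pos a) (pos b) (pos p))
    (h2 : 0 ≤ orient (pos b) (pos c) (pos p)) : orient (pos c) (pos a) (pos p) < 0 := by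
  by_contra h3
  have := h.mem_of_mem_convexHull (s := {a, b, c})
    (mem_convexHull_of_orient h0 h1 h2 (not_lt.mp h3)) (by rw [Set.image_insert_eq, Set.image_pair])
  simp [hpa, hpb, hpc] at this

/-- Makes the angular order around a vertex o transitive: if the turn from u to w were not positive,
o would lie in the triangle uvw. -/
theorem ConvexIndependent.orient_trans {V : Type*} {pos : V → ℝ × ℝ}
    (h : ConvexIndependent ℝ pos) {o u v w : V}
    (h1 : 0 < orient (pos o) (pos u) (pos v)) (h2 : 0 < orient (pos o) (pos v) (pos w)) :
    0 < orient (pos o) (pos u) (pos w) := by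
  obtain ⟨ou, ov, uv⟩ := ne_of_orient_pos h1
  obtain ⟨-, ow, vw⟩ := ne_of_orient_pos h2
  by_contra hc
  have e : orient (pos u) (pos v) (pos w) = orient (pos o) (pos u) (pos v) +
      orient (pos o) (pos v) (pos w) - orient (pos o) (pos u) (pos w) := by
    unfold orient; ring
  have := h.orient_neg (a := u) (b := v) (c := w) (p := o) ou ov ow (by linarith)
    (by rw [orient_rotate]; exact h1.le) (by rw [orient_rotate]; exact h2.le)
  rw [orient_rotate, orient_swap] at this
  have huw : u = w := by
    by_contra huw
    exact h.orient_ne_zero ou ow huw (by linarith)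
  subst huw
  rw [orient_swap] at h2
  linarith

/-- If u, v, w did not turn left, v would lie in the triangle ouw. -/
theorem ConvexIndependent.orient_pos_of_base {V : Type*} {pos : V → ℝ × ℝ}
    (h : ConvexIndependent ℝ pos) {o u v w : V}
    (h1 : 0 < orient (pos o) (pos u) (pos v)) (h2 : 0 < orient (pos o) (pos v) (pos w)) :
    0 < orient (pos u) (pos v) (pos w) := by
  have h3 := h.orient_trans h1 h2
  obtain ⟨ou, ov, uv⟩ := ne_of_orient_pos h1
  obtain ⟨-, ow, vw⟩ := ne_of_orient_pos h2
  by_contra hc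
  have := h.orient_neg (a := o) (b := u) (c := w) (p := v) ov.symm uv.symm vw h3 h1.le
    (by rw [orient_swap]; linarith)
  rw [← orient_rotate] at this
  linarith

/-! ### Reasoning about programs -/

/-- Started in `s`, the program `c` halts after at most `B` steps in a state that satisfies `Q`. -/
def RunsWithin (W : ℕ) (c : RamProgram) (s : RamState) (B : ℕ) (Q : RamState → Prop) : Prop :=
  ∃ s' t, t ≤ B ∧ RamExec W c s t s' ∧ Q s'

namespace RunsWithin

variable {W : ℕ} {c d : RamProgram} {s : RamState} {B B' : ℕ} {Q Q' : RamState → Prop}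

theorem mono (h : RunsWithin W c s B Q) (hB : B ≤ B') (hQ : ∀ s', Q s' → Q' s') :
    RunsWithin W c s B' Q' := by
  obtain ⟨s', t, ht, hc, hs⟩ := h
  exact ⟨s', t, ht.trans hB, hc, hQ _ hs⟩

theorem skip (h : Q s) : RunsWithin W .skip s 1 Q := ⟨s, 1, le_rfl, .skip s, h⟩

theorem setReg {x : ℕ} {e : IntExpr} (hW : e.eval s ≤ W)
    (h : Q { s with reg := Function.update s.reg x (e.eval s) }) :
    RunsWithin W (.setReg x e) s (e.cost + 1) Q := ⟨_, _, le_rfl, .setReg s x e hW, h⟩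

theorem storeInt {a : ℕ} {i e : IntExpr} (hW : e.eval s ≤ W)
    (h : Q { s with iarr :=
      Function.update s.iarr a (Function.update (s.iarr a) (i.eval s) (e.eval s)) }) :
    RunsWithin W (.storeInt a i e) s (i.cost + e.cost + 1) Q :=
  ⟨_, _, le_rfl, .storeInt s a i e hW, h⟩

theorem seq (h : RunsWithin W c s B fun s' => RunsWithin W d s' B' Q) :
    RunsWithin W (.seq c d) s (B + B') Q := by
  obtain ⟨s', t, ht, hc, s'', t', ht', hd, hs⟩ := h
  exact ⟨s'', t + t', by omega, .seq hc hd, hs⟩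

theorem branch {b : RamTest} (h1 : b.Holds s → RunsWithin W c s B Q)
    (h2 : ¬ b.Holds s → RunsWithin W d s B Q) :
    RunsWithin W (.branch b c d) s (b.cost + B) Q := by
  by_cases hb : b.Holds s
  · obtain ⟨s', t, ht, hc, hs⟩ := h1 hb
    exact ⟨s', _, by omega, .branchTrue hb hc, hs⟩
  · obtain ⟨s', t, ht, hc, hs⟩ := h2 hb
    exact ⟨s', _, by omega, .branchFalse hb hc, hs⟩

/-- The invariant is indexed by the number of completed rounds; the extra `b.cost` pays for the
final, failing test. -/
theorem loop {b : RamTest} {I : ℕ → RamState → Prop} (N : ℕ)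
    (hI : ∀ j < N, ∀ s, I j s → b.Holds s ∧ RunsWithin W c s B (I (j + 1)))
    (hN : ∀ s, I N s → ¬ b.Holds s) (h0 : I 0 s) :
    RunsWithin W (.loop b c) s ((b.cost + B) * N + b.cost) (I N) := by
  have key : ∀ m j, j + m = N → ∀ s, I j s →
      RunsWithin W (.loop b c) s ((b.cost + B) * m + b.cost) (I N) := by
    intro m
    induction m with
    | zero =>
      rintro j rfl s hs
      exact ⟨s, _, by simp, .loopDone (hN s hs), hs⟩
    | succ m ih =>
      intro j hj s hs
      obtain ⟨hb, s', t, ht, hc, hs'⟩ := hI j (by omega) s hs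
      obtain ⟨s'', t', ht', hl, hs''⟩ := ih (j + 1) (by omega) s' hs'
      refine ⟨s'', _, ?_, .loopStep hb hc hl, hs''⟩
      rw [mul_add_one]
      omega
  exact key N 0 (zero_add _) s h0

end RunsWithin

/-- Run `c` with the register `x` ranging over all numbers below the content of register `0`. -/
def forLoop (x : ℕ) (c : RamProgram) : RamProgram :=
  .seq (.setReg x (.const 0))
    (.loop (.intLt (.reg x) (.reg 0)) (.seq c (.setReg x (.add (.reg x) (.const 1)))))

/-- Each round adds a test (3 steps) and an increment (4) to the body; the 5 is the initial
assignment (2) and the last test (3). The counter reaches n, hence `n ≤ W`. -/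
theorem RunsWithin.forLoop {W n B x : ℕ} {c : RamProgram} {s : RamState}
    {I : ℕ → RamState → Prop} (hx : x ≠ 0) (hn : s.reg 0 = n) (hW : n ≤ W)
    (h0 : I 0 { s with reg := Function.update s.reg x 0 })
    (hI : ∀ j < n, ∀ s, s.reg 0 = n → s.reg x = j → I j s →
      RunsWithin W c s B fun s' => s'.reg 0 = n ∧ s'.reg x = j ∧
        I (j + 1) { s' with reg := Function.update s'.reg x (j + 1) }) :
    RunsWithin W (forLoop x c) s ((B + 7) * n + 5) fun s' => s'.reg 0 = n ∧ I n s' := by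
  have h := RunsWithin.loop (W := W) (b := .intLt (.reg x) (.reg 0))
    (c := .seq c (.setReg x (.add (.reg x) (.const 1)))) (B := B + 4)
    (s := { s with reg := Function.update s.reg x 0 })
    (I := fun j s => s.reg 0 = n ∧ s.reg x = j ∧ I j s) n ?_ ?_ ?_
  · obtain ⟨s', t, ht, hl, h1, -, h2⟩ := h
    refine ⟨s', _, ?_, .seq (.setReg s x (.const 0) (Nat.zero_le _)) hl, h1, h2⟩
    simp only [RamTest.cost, IntExpr.cost] at ht ⊢
    calc _ ≤ 2 + ((1 + 1 + 1 + (B + 4)) * n + (1 + 1 + 1)) := by omega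
      _ = _ := by ring
  · rintro j hj s ⟨h1, h2, h3⟩
    refine ⟨by simpa [RamTest.Holds, IntExpr.eval, h1, h2] using hj, ?_⟩
    refine RunsWithin.seq ((hI j hj s h1 h2 h3).mono le_rfl ?_)
    rintro s' ⟨e1, e2, e3⟩
    refine RunsWithin.setReg ?_ ?_
    · simp only [IntExpr.eval, e2]; omega
    · simp only [IntExpr.eval, e2]
      exact ⟨by simp [Function.update_of_ne hx.symm, e1], by simp, e3⟩
  · rintro s ⟨h1, h2, -⟩
    simp [RamTest.Holds, IntExpr.eval, h1, h2]
  · exact ⟨by simp [Function.update_of_ne hx.symm, hn], by simp, h0⟩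

/-! ### The program -/

/-- Store in integer array `1`, at each position, the vertex that has as many predecessors; the
test `b` decides whether the vertex in register `3` precedes the one in register `2`. -/
def rankProgram (b : RamTest) : RamProgram :=
  forLoop 2 (.seq (.setReg 4 (.const 0)) (.seq
    (forLoop 3 (.branch b (.setReg 4 (.add (.reg 4) (.const 1))) .skip))
    (.storeInt 1 (.reg 4) (.reg 2))))

/-- The adjacency of the vertices whose ranks are in registers `2` and `5`. -/
def adjEntry : IntExpr :=
  .load 0 (.add (.mul (.load 1 (.reg 2)) (.reg 0)) (.load 1 (.reg 5)))

/-- For each rank `k` in increasing order, run over the ranks `l > k` in the order that is described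
by the expression `e`.  Integer array `2` holds at `l` the number of edges to `l` from ranks below
`k`, register `4` the sum of those numbers over the ranks visited before `l`. -/
def sumProgram (e : IntExpr) : RamProgram :=
  forLoop 2 (.seq (.setReg 4 (.const 0)) (forLoop 3 (.seq (.setReg 5 e)
    (.branch (.intLt (.reg 2) (.reg 5))
      (.seq (.setReg 1 (.add (.reg 1) (.mul adjEntry (.reg 4))))
        (.seq (.setReg 4 (.add (.reg 4) (.load 2 (.reg 5))))
          (.storeInt 2 (.reg 5) (.add (.load 2 (.reg 5)) adjEntry))))
      .skip))))

/-- Count the pairs of edges in a prescribed position with respect to a linear order. -/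
def countProgram (b : RamTest) (e : IntExpr) : RamProgram :=
  .seq (rankProgram b) (sumProgram e)

/-! ### Correctness of the ranking phase -/

theorem card_filter_equiv_lt {n : ℕ} (e : Equiv.Perm (Fin n)) (v : Fin n) :
    (Finset.univ.filter fun u => e u < e v).card = e v := by
  rw [← Fin.card_Iio (e v)]
  refine Finset.card_bij (fun u _ => e u) ?_ ?_ ?_
  · intro u hu; simpa using hu
  · intro u _ u' _ h; exact e.injective h
  · intro i hi
    exact ⟨e.symm i, by simpa using hi, by simp⟩

/-- The outer invariant says that the vertices below j are stored at their ranks, the inner one that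
register 4 counts the predecessors of j among the vertices below i. The test is specified on all
states with the original real arrays because only those and registers 2 and 3 matter. -/
theorem rankProgram_runs {n W : ℕ} (hW : n ≤ W) {b : RamTest} {s₀ : RamState}
    (e : Equiv.Perm (Fin n))
    (hb : ∀ (s : RamState) (u v : Fin n), s.rarr = s₀.rarr → s.reg 3 = u → s.reg 2 = v →
      (b.Holds s ↔ e u < e v)) (hn : s₀.reg 0 = n) :
    RunsWithin W (rankProgram b) s₀ (((b.cost + 11) * n + 17) * n + 5) fun s =>
      s.reg 0 = n ∧ s.reg 1 = s₀.reg 1 ∧ (∀ a ≠ 1, s.iarr a = s₀.iarr a) ∧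
        ∀ u : Fin n, s.iarr 1 (e u) = u := by
  have h := RunsWithin.forLoop (W := W) (n := n) (x := 2) (B := (b.cost + 11) * n + 10)
    (c := .seq (.setReg 4 (.const 0)) (.seq
      (forLoop 3 (.branch b (.setReg 4 (.add (.reg 4) (.const 1))) .skip))
      (.storeInt 1 (.reg 4) (.reg 2)))) (s := s₀)
    (I := fun j s => s.reg 1 = s₀.reg 1 ∧ s.rarr = s₀.rarr ∧ (∀ a ≠ 1, s.iarr a = s₀.iarr a) ∧
      ∀ u : Fin n, (u : ℕ) < j → s.iarr 1 (e u) = u) (by norm_num) hn hW (by simp) ?_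
  · refine h.mono le_rfl ?_
    rintro s ⟨h0, h1, -, h3, h4⟩
    exact ⟨h0, h1, h3, fun u => h4 u u.2⟩
  intro j hj s h0 h2 hI
  have hin := RunsWithin.forLoop (W := W) (n := n) (x := 3) (B := b.cost + 4)
    (c := .branch b (.setReg 4 (.add (.reg 4) (.const 1))) .skip)
    (s := { s with reg := Function.update s.reg 4 0 })
    (I := fun i s' => s'.reg 2 = j ∧ s'.reg 1 = s.reg 1 ∧ s'.rarr = s.rarr ∧ s'.iarr = s.iarr ∧
      s'.reg 4 = (Finset.univ.filter fun u : Fin n => (u : ℕ) < i ∧ e u < e ⟨j, hj⟩).card)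
    (by norm_num) (by simpa using h0) hW (by simp [h2]) ?_
  · refine (RunsWithin.seq (RunsWithin.setReg (Nat.zero_le _) (RunsWithin.seq
      (hin.mono le_rfl ?_)))).mono (B := 2 + (((b.cost + 4 + 7) * n + 5) + 3)) ?_ fun s' h => h
    · rintro s' ⟨g0, g2, g1, gr, gi, g4⟩
      have g4' : s'.reg 4 = e ⟨j, hj⟩ := by
        rw [g4, ← card_filter_equiv_lt]
        congr 1
        ext u
        simp
      refine RunsWithin.storeInt ?_ ?_
      · simp only [IntExpr.eval, g2]; omega
      · obtain ⟨I1, I2, I3, I4⟩ := hI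
        refine ⟨g0, g2, by simp [g1, I1], by simp [gr, I2], ?_, ?_⟩
        · intro a ha
          simp [Function.update_of_ne ha, gi, I3 a ha]
        · intro u hu
          simp only [IntExpr.eval, g2, g4', Function.update_self]
          by_cases huj : u = ⟨j, hj⟩
          · subst huj; simp
          · rw [Function.update_of_ne, gi, I4 u]
            · have : (u : ℕ) ≠ j := fun h => huj (Fin.ext h)
              omega
            · intro h
              exact huj (e.injective (Fin.ext h))
    · ring_nf; omega
  · intro i hi s' g0 g3 ⟨g2, g1, gr, gi, g4⟩
    have hb' := hb s' ⟨i, hi⟩ ⟨j, hj⟩ (gr.trans hI.2.1) g3 g2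
    -- A vertex does not precede itself, so at most n - 1 predecessors are counted and the increment
    -- fits in a word.
    have hle : s'.reg 4 < n := by
      rw [g4]
      calc _ < (Finset.univ : Finset (Fin n)).card := by
            apply Finset.card_lt_card
            rw [Finset.ssubset_univ_iff]
            intro h
            have := h ▸ Finset.mem_univ (⟨j, hj⟩ : Fin n)
            simp at this
        _ = n := by simp
    refine RunsWithin.branch (fun hh => ?_) (fun hh => ?_)
    · refine (RunsWithin.setReg ?_ ?_ : RunsWithin _ _ _ _ _)
      · simp only [IntExpr.eval]; omega
      · refine ⟨by simpa using g0, by simpa using g3, by simpa using g2, by simpa using g1, gr, gi, ?_⟩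
        have hins : (Finset.univ.filter fun u : Fin n => (u : ℕ) < i + 1 ∧ e u < e ⟨j, hj⟩) =
            insert ⟨i, hi⟩
              (Finset.univ.filter fun u : Fin n => (u : ℕ) < i ∧ e u < e ⟨j, hj⟩) := by
          ext u
          simp only [Finset.mem_filter, Finset.mem_univ, true_and, Finset.mem_insert, Fin.ext_iff]
          constructor
          · rintro ⟨h1, h2⟩
            by_cases hui : (u : ℕ) = i
            · exact Or.inl hui
            · exact Or.inr ⟨by omega, h2⟩
          · rintro (h1 | ⟨h1, h2⟩)
            · obtain rfl : u = ⟨i, hi⟩ := Fin.ext h1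
              exact ⟨by simp, hb'.mp hh⟩
            · exact ⟨by omega, h2⟩
        rw [hins, Finset.card_insert_of_notMem (by simp)]
        simp [IntExpr.eval, g4]
    · refine (RunsWithin.skip ?_).mono (B := 1) (by omega) fun s' h => h
      refine ⟨g0, g3, by simpa using g2, by simpa using g1, gr, gi, ?_⟩
      have hins : (Finset.univ.filter fun u : Fin n => (u : ℕ) < i + 1 ∧ e u < e ⟨j, hj⟩) =
          Finset.univ.filter fun u : Fin n => (u : ℕ) < i ∧ e u < e ⟨j, hj⟩ := by
        ext u
        simp only [Finset.mem_filter, Finset.mem_univ, true_and]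
        constructor
        · rintro ⟨h1, h2⟩
          refine ⟨?_, h2⟩
          by_contra hc
          have hui : (u : ℕ) = i := by omega
          obtain rfl : u = ⟨i, hi⟩ := Fin.ext hui
          exact hh (hb'.mpr h2)
        · rintro ⟨h1, h2⟩
          exact ⟨by omega, h2⟩
      rw [hins]
      simpa using g4

/-! ### Correctness of the summation phase -/

/-- The number of edges from ranks below `k` to the rank `l`. -/
def edgesBelow (B : ℕ → ℕ → ℕ) (k l : ℕ) : ℕ :=
  ∑ i ∈ Finset.range k, if i < l then B i l else 0

/-- The number of edges from ranks below `k` to ranks above `k` among the first `m` visited. -/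
def visitedEdges (B : ℕ → ℕ → ℕ) (τ : ℕ → ℕ) (k m : ℕ) : ℕ :=
  ∑ j ∈ Finset.range m, if k < τ j then edgesBelow B k (τ j) else 0

/-- The number of pairs that involve an edge from `k` to one of the first `m` ranks visited. -/
def rowPairs (B : ℕ → ℕ → ℕ) (τ : ℕ → ℕ) (k m : ℕ) : ℕ :=
  ∑ j ∈ Finset.range m, if k < τ j then B k (τ j) * visitedEdges B τ k j else 0

theorem Finset.sum_range_le_mul {f : ℕ → ℕ} {m c : ℕ} (h : ∀ i < m, f i ≤ c) :
    ∑ i ∈ Finset.range m, f i ≤ m * c := by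
  simpa using Finset.sum_le_card_nsmul (Finset.range m) f c (by simpa using h)

/-! ### Polynomial bounds that keep the counters within a machine word -/

section Bounds

variable {B : ℕ → ℕ → ℕ} {τ : ℕ → ℕ}

theorem edgesBelow_le (hB : ∀ i j, B i j ≤ 1) (k l : ℕ) : edgesBelow B k l ≤ k := by
  refine (Finset.sum_range_le_mul (c := 1) fun i _ => ?_).trans (mul_one k).le
  split_ifs
  exacts [hB _ _, Nat.zero_le _]

theorem visitedEdges_le (hB : ∀ i j, B i j ≤ 1) (k m : ℕ) : visitedEdges B τ k m ≤ m * k := by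
  refine Finset.sum_range_le_mul fun j _ => ?_
  split_ifs
  exacts [edgesBelow_le hB _ _, Nat.zero_le _]

theorem rowPairs_le (hB : ∀ i j, B i j ≤ 1) (k m : ℕ) : rowPairs B τ k m ≤ m * (m * k) := by
  refine Finset.sum_range_le_mul fun j hj => ?_
  split_ifs
  · calc _ ≤ 1 * (j * k) := Nat.mul_le_mul (hB _ _) (visitedEdges_le hB _ _)
      _ ≤ m * k := by rw [one_mul]; gcongr
  · exact Nat.zero_le _

end Bounds

/-- During round k, array 2 already holds the counts for k + 1 at the visited ranks above k and
still those for k elsewhere. Register 1 is updated before register 4, and register 4 before the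
array, so an edge is paired only with edges to strictly earlier visited ranks that start below k. -/
theorem sumProgram_runs {n : ℕ} {e : IntExpr} {τ : ℕ → ℕ} {s₀ : RamState}
    {B : ℕ → ℕ → ℕ} (hB : ∀ i j, B i j ≤ 1)
    (hadj : ∀ i < n, ∀ j < n, s₀.iarr 0 (s₀.iarr 1 i * n + s₀.iarr 1 j) = B i j)
    (he : ∀ s : RamState, s.reg 0 = n → s.reg 3 < n → e.eval s = τ (s.reg 3))
    (hτ : ∀ m < n, τ m < n) (hinj : ∀ m < n, ∀ m' < n, τ m = τ m' → m = m')
    (hn : s₀.reg 0 = n) (h1 : s₀.reg 1 = 0) (h2 : ∀ p, s₀.iarr 2 p = 0) :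
    RunsWithin ((n + 2) ^ 5) (sumProgram e) s₀ (((e.cost + 53) * n + 14) * n + 5) fun s =>
      s.reg 1 = ∑ k ∈ Finset.range n, rowPairs B τ k n := by
  have hnW : n ≤ (n + 2) ^ 5 := by
    calc n ≤ n + 2 := by omega
      _ = (n + 2) ^ 1 := (pow_one _).symm
      _ ≤ _ := Nat.pow_le_pow_right (by omega) (by norm_num)
  have h := RunsWithin.forLoop (W := (n + 2) ^ 5) (n := n) (x := 2) (B := (e.cost + 53) * n + 7)
    (c := .seq (.setReg 4 (.const 0)) (forLoop 3 (.seq (.setReg 5 e)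
    (.branch (.intLt (.reg 2) (.reg 5))
      (.seq (.setReg 1 (.add (.reg 1) (.mul adjEntry (.reg 4))))
        (.seq (.setReg 4 (.add (.reg 4) (.load 2 (.reg 5))))
          (.storeInt 2 (.reg 5) (.add (.load 2 (.reg 5)) adjEntry))))
      .skip)))) (s := s₀)
    (I := fun k s => s.reg 1 = ∑ k' ∈ Finset.range k, rowPairs B τ k' n ∧
      (∀ a ≠ 2, s.iarr a = s₀.iarr a) ∧ ∀ l < n, s.iarr 2 l = edgesBelow B k l)
    (by norm_num) hn hnW ?_ ?_
  · refine h.mono le_rfl ?_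
    rintro s ⟨-, h1, -⟩
    exact h1
  · refine ⟨by simp [h1], fun a _ => rfl, fun l _ => by simp [h2, edgesBelow]⟩
  rintro k hk s g0 g2 ⟨g1, ga, gR⟩
  have hin := RunsWithin.forLoop (W := (n + 2) ^ 5) (n := n) (x := 3) (B := e.cost + 46)
    (c := .seq (.setReg 5 e) (.branch (.intLt (.reg 2) (.reg 5))
      (.seq (.setReg 1 (.add (.reg 1) (.mul adjEntry (.reg 4))))
        (.seq (.setReg 4 (.add (.reg 4) (.load 2 (.reg 5))))
          (.storeInt 2 (.reg 5) (.add (.load 2 (.reg 5)) adjEntry))))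
      .skip))
    (s := { s with reg := Function.update s.reg 4 0 })
    (I := fun m s' => s'.reg 2 = k ∧
      s'.reg 1 = ∑ k' ∈ Finset.range k, rowPairs B τ k' n + rowPairs B τ k m ∧
      s'.reg 4 = visitedEdges B τ k m ∧ (∀ a ≠ 2, s'.iarr a = s₀.iarr a) ∧
      ∀ j < n, s'.iarr 2 (τ j) =
        edgesBelow B k (τ j) + if j < m ∧ k < τ j then B k (τ j) else 0)
    (by norm_num) (by simpa using g0) hnW ?_ ?_
  · refine (RunsWithin.seq (RunsWithin.setReg (Nat.zero_le _) (hin.mono le_rfl ?_))).mono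
      (B := 2 + ((e.cost + 46 + 7) * n + 5)) (by ring_nf; omega) fun s' h => h
    rintro s' ⟨f0, f2, f1, f4, fa, fR⟩
    refine ⟨f0, f2, ?_, fa, ?_⟩
    · rw [Finset.sum_range_succ]
      simpa using f1
    -- The inner invariant is indexed by visiting times; since every rank is visited, it yields the
    -- outer invariant at every rank.
    · have hsurj : Function.Surjective fun m : Fin n => (⟨τ m, hτ m m.2⟩ : Fin n) := by
        apply Finite.surjective_of_injective
        intro m m' h
        exact Fin.ext (hinj m m.2 m' m'.2 (Fin.mk.inj h))
      intro l hl
      obtain ⟨m, hm⟩ := hsurj ⟨l, hl⟩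
      obtain rfl : τ m = l := Fin.mk.inj hm
      rw [edgesBelow, Finset.sum_range_succ, ← edgesBelow]
      simpa using fR m m.2
  · refine ⟨by simpa using g2, by simpa [rowPairs] using g1, by simp [visitedEdges], ga, ?_⟩
    intro j hj
    simp [gR _ (hτ j hj)]
  · rintro m hm s' f0 f3 ⟨f2, f1, f4, fa, fR⟩
    have hev : e.eval s' = τ m := by rw [he s' f0 (by omega), f3]
    have hn2 : n * n ≤ (n + 2) ^ 5 := by
      calc n * n ≤ (n + 2) * (n + 2) := by gcongr <;> omega
        _ = (n + 2) ^ 2 := by ring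
        _ ≤ _ := Nat.pow_le_pow_right (by omega) (by norm_num)
    -- Finished rows contribute at most n times n³ to register 1, the current row at most n³.
    have hn4 : n * (n * (n * n)) + n * (n * n) ≤ (n + 2) ^ 5 := by
      calc _ = n ^ 3 * (n + 1) := by ring
        _ ≤ (n + 2) ^ 3 * (n + 2) := by gcongr <;> omega
        _ = (n + 2) ^ 4 := by ring
        _ ≤ _ := Nat.pow_le_pow_right (by omega) (by norm_num)
    have hW1 : ∑ k' ∈ Finset.range k, rowPairs B τ k' n + rowPairs B τ k (m + 1) ≤
        (n + 2) ^ 5 := by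
      refine le_trans (Nat.add_le_add (b := n * (n * (n * n))) (d := n * (n * n)) ?_ ?_) hn4
      · refine (Finset.sum_range_le_mul (c := n * (n * n)) fun i hi => ?_).trans (by gcongr)
        exact (rowPairs_le hB _ _).trans (by gcongr; omega)
      · exact (rowPairs_le hB _ _).trans (by gcongr <;> omega)
    have hW4 : visitedEdges B τ k (m + 1) ≤ (n + 2) ^ 5 :=
      (visitedEdges_le hB _ _).trans ((Nat.mul_le_mul hm hk.le).trans hn2)
    have hrow : rowPairs B τ k (m + 1) = rowPairs B τ k m +
        if k < τ m then B k (τ m) * visitedEdges B τ k m else 0 := by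
      rw [rowPairs, Finset.sum_range_succ, ← rowPairs]
    have hvis : visitedEdges B τ k (m + 1) = visitedEdges B τ k m +
        if k < τ m then edgesBelow B k (τ m) else 0 := by
      rw [visitedEdges, Finset.sum_range_succ, ← visitedEdges]
    have hRm : s'.iarr 2 (τ m) = edgesBelow B k (τ m) := by simp [fR m hm]
    -- Injectivity of `τ` ensures that the write at `τ m` leaves the entries of all other visiting
    -- times unchanged.
    have hR : ∀ j < n, edgesBelow B k (τ j) + (if j < m + 1 ∧ k < τ j then B k (τ j) else 0) =
        Function.update (s'.iarr 2) (τ m)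
          (edgesBelow B k (τ m) + if k < τ m then B k (τ m) else 0) (τ j) := by
      intro j hj
      by_cases hjm : j = m
      · subst hjm; simp
      · rw [Function.update_of_ne (fun h => hjm (hinj j hj m hm h)), fR j hj]
        have : j < m + 1 ↔ j < m := by omega
        simp only [this]
    have hA : s'.iarr 0 (s'.iarr 1 k * n + s'.iarr 1 (τ m)) = B k (τ m) := by
      rw [fa 0 (by norm_num), fa 1 (by norm_num), hadj k hk _ (hτ m hm)]
    refine (RunsWithin.seq (RunsWithin.setReg ?_ (RunsWithin.branch (B := 41) ?_ ?_))).mono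
      (B' := e.cost + 46) ?_ fun s' h => h
    · rw [hev]
      have := hτ m hm
      omega
    · intro hlt
      replace hlt : k < τ m := by simpa [RamTest.Holds, IntExpr.eval, f2, hev] using hlt
      rw [if_pos hlt] at hrow hvis
      refine (RunsWithin.seq (RunsWithin.setReg ?_ (RunsWithin.seq (RunsWithin.setReg ?_
        (RunsWithin.storeInt ?_ ?_))))).mono ?_ fun s' h => h
      · simpa [IntExpr.eval, adjEntry, f0, f1, f2, f4, hA, hev, hrow, add_assoc] using hW1
      · simpa [IntExpr.eval, adjEntry, f0, f1, f2, f4, hA, hev, hRm, hvis] using hW4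
      · have b1 := edgesBelow_le hB k (τ m)
        have b2 := hB k (τ m)
        simp [IntExpr.eval, adjEntry, f0, f1, f2, f4, hA, hev, hRm]
        omega
      · refine ⟨by simpa using f0, by simpa using f3, by simpa using f2, ?_, ?_, ?_, ?_⟩
        · simp [IntExpr.eval, adjEntry, f0, f1, f2, f4, hA, hev, hrow, add_assoc]
        · simp [IntExpr.eval, f4, hev, hRm, hvis]
        · intro a ha
          simp [Function.update_of_ne ha, fa a ha]
        · intro j hj
          rw [hR j hj]
          simp [IntExpr.eval, adjEntry, f0, f2, hA, hev, hRm, hlt]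
      · simp [IntExpr.cost, adjEntry]
    · intro hlt
      replace hlt : ¬ k < τ m := by simpa [RamTest.Holds, IntExpr.eval, f2, hev] using hlt
      rw [if_neg hlt] at hrow hvis
      refine (RunsWithin.skip ?_).mono (B := 1) (by omega) fun s' h => h
      refine ⟨by simpa using f0, by simpa using f3, by simpa using f2, ?_, ?_, fa, ?_⟩
      · simp [f1, hrow]
      · simp [f4, hvis]
      · intro j hj
        rw [hR j hj, if_neg hlt, add_zero, ← hRm, Function.update_eq_self]
    · simp [RamTest.cost, IntExpr.cost]

/-! ### Pairs of edges and linear orders -/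

open Classical in
/-- The quadruples of ranks that represent the pairs of edges counted by the program. -/
noncomputable def countedQuadruples {n : ℕ} (G : SimpleGraph (Fin n)) (e τ : Equiv.Perm (Fin n)) :
    Finset (Fin n × Fin n × Fin n × Fin n) :=
  Finset.univ.filter fun q => q.1 < τ q.2.1 ∧ q.1 < τ q.2.2.1 ∧ q.2.2.1 < q.2.1 ∧ q.2.2.2 < q.1 ∧
    G.Adj (e.symm q.1) (e.symm (τ q.2.1)) ∧ G.Adj (e.symm q.2.2.2) (e.symm (τ q.2.2.1))

theorem mem_countedQuadruples {n : ℕ} {G : SimpleGraph (Fin n)} {e τ : Equiv.Perm (Fin n)}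
    {q : Fin n × Fin n × Fin n × Fin n} : q ∈ countedQuadruples G e τ ↔
      q.1 < τ q.2.1 ∧ q.1 < τ q.2.2.1 ∧ q.2.2.1 < q.2.1 ∧ q.2.2.2 < q.1 ∧
        G.Adj (e.symm q.1) (e.symm (τ q.2.1)) ∧
        G.Adj (e.symm q.2.2.2) (e.symm (τ q.2.2.1)) := by
  simp [countedQuadruples]

/-- Directing edges upward in `e` and ordering a pair by its lower endpoints a < c makes its
representation unique: the quadruple consists of the rank of c, the visiting times of d and b, and
the rank of a. `hshare` disposes of equal lower endpoints; equal upper endpoints are covered by the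
strict inequality in `hcross`. -/
theorem numCrossings_eq_card {n : ℕ} {G : SimpleGraph (Fin n)} {pos : Fin n → ℝ × ℝ}
    (e τ : Equiv.Perm (Fin n))
    (hcross : ∀ a b c d, G.Adj a b → G.Adj c d → e a < e b → e c < e d → e a < e c →
      (EdgesCross pos s(a, b) s(c, d) ↔ e c < e b ∧ τ.symm (e b) < τ.symm (e d)))
    (hshare : ∀ a b d, G.Adj a b → G.Adj a d → b ≠ d → e a < e b → e a < e d →
      ¬ EdgesCross pos s(a, b) s(a, d)) :
    numCrossings G pos = (countedQuadruples G e τ).card := by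
  have hor : ∀ x ∈ G.edgeSet, ∃ a b, x = s(a, b) ∧ G.Adj a b ∧ e a < e b := by
    intro x hx
    induction x with
    | h a b =>
      have hab : G.Adj a b := hx
      rcases lt_or_gt_of_ne (e.injective.ne hab.ne) with h | h
      · exact ⟨a, b, rfl, hab, h⟩
      · exact ⟨b, a, Sym2.eq_swap, hab.symm, h⟩
  have hinj : ∀ a b c d, e a < e b → e c < e d → s(a, b) = s(c, d) → a = c ∧ b = d := by
    intro a b c d hab hcd h
    rcases Sym2.eq_iff.mp h with h | ⟨rfl, rfl⟩
    · exact h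
    · exact absurd hab hcd.asymm
  symm
  rw [numCrossings, ← Set.ncard_coe_finset]
  refine Set.ncard_congr (fun q _ => s(s(e.symm q.2.2.2, e.symm (τ q.2.2.1)),
    s(e.symm q.1, e.symm (τ q.2.1)))) ?_ ?_ ?_
  · rintro ⟨k, m, m', i⟩ hq
    obtain ⟨h1, h2, h3, h4, h5, h6⟩ := mem_countedQuadruples.mp hq
    refine ⟨_, _, rfl, h6, h5, ?_, ?_⟩
    · intro h
      have := hinj _ _ _ _ (by simpa using h4.trans h2) (by simpa using h1) h
      exact h4.ne (e.symm.injective this.1)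
    · rw [hcross _ _ _ _ h6 h5 (by simpa using h4.trans h2) (by simpa using h1) (by simpa using h4)]
      simpa using ⟨h2, h3⟩
  · rintro ⟨k, m, m', i⟩ ⟨k₁, m₁, m₁', i₁⟩ hq hq₁ h
    obtain ⟨h1, h2, h3, h4, h5, h6⟩ := mem_countedQuadruples.mp hq
    obtain ⟨g1, g2, g3, g4, g5, g6⟩ := mem_countedQuadruples.mp hq₁
    simp only at h1 h2 h3 h4 g1 g2 g3 g4
    have a1 := h4.trans h2
    have b1 := g4.trans g2
    rcases Sym2.eq_iff.mp h with ⟨e1, e2⟩ | ⟨e1, e2⟩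
    · have e1 := hinj _ _ _ _ (by simpa using a1) (by simpa using b1) e1
      have e2 := hinj _ _ _ _ (by simpa using h1) (by simpa using g1) e2
      simp only [EmbeddingLike.apply_eq_iff_eq] at e1 e2
      simp [e1, e2]
    -- Matching the edges crosswise would reverse the order of the two lower endpoints.
    · have e1 := hinj _ _ _ _ (by simpa using a1) (by simpa using g1) e1
      have e2 := hinj _ _ _ _ (by simpa using h1) (by simpa using b1) e2
      simp only [EmbeddingLike.apply_eq_iff_eq] at e1 e2
      rw [e1.1, e2.1] at h4
      exact absurd h4 g4.asymm
  · rintro p ⟨x, y, rfl, hx, hy, hxy, hc⟩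
    obtain ⟨a, b, rfl, hab, hab'⟩ := hor x hx
    obtain ⟨c, d, rfl, hcd, hcd'⟩ := hor y hy
    have key : ∀ a b c d, G.Adj a b → G.Adj c d → e a < e b → e c < e d → e a < e c →
        EdgesCross pos s(a, b) s(c, d) → ∃ q, ∃ _ : q ∈ countedQuadruples G e τ,
          s(s(e.symm q.2.2.2, e.symm (τ q.2.2.1)), s(e.symm q.1, e.symm (τ q.2.1))) =
            s(s(a, b), s(c, d)) := by
      intro a b c d hab hcd hab' hcd' hac hc
      obtain ⟨h1, h2⟩ := (hcross _ _ _ _ hab hcd hab' hcd' hac).mp hc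
      exact ⟨(e c, τ.symm (e d), τ.symm (e b), e a), mem_countedQuadruples.mpr (by simp [*]), by simp⟩
    rcases lt_trichotomy (e a) (e c) with h | h | h
    · exact key _ _ _ _ hab hcd hab' hcd' h hc
    · obtain rfl := e.injective h
      exact absurd hc (hshare _ _ _ hab hcd (fun h => hxy (by rw [h])) hab' hcd')
    · obtain ⟨q, hq, h⟩ := key _ _ _ _ hcd hab hcd' hab' h hc.symm
      exact ⟨q, hq, h.trans Sym2.eq_swap⟩

/-- Expanding the nested products turns the sum into the indicator of the counted quadruples, summed
over all quadruples. -/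
theorem sum_rowPairs_eq_card {n : ℕ} {G : SimpleGraph (Fin n)} (e τ : Equiv.Perm (Fin n))
    {B : ℕ → ℕ → ℕ} {t : ℕ → ℕ} (ht : ∀ m : Fin n, t m = τ m)
    (hB : ∀ i j : Fin n, B i j = open Classical in if G.Adj (e.symm i) (e.symm j) then 1 else 0) :
    ∑ k ∈ Finset.range n, rowPairs B t k n = (countedQuadruples G e τ).card := by
  classical
  have hlt : ∀ (k : Fin n) (f : ℕ → ℕ),
      ∑ i ∈ Finset.range (k : ℕ), f i = ∑ i : Fin n, if i < k then f i else 0 := by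
    intro k f
    have h : Finset.range (k : ℕ) = (Finset.range n).filter (· < (k : ℕ)) := by
      ext i
      simp only [Finset.mem_range, Finset.mem_filter]
      have := k.2
      omega
    rw [h, Finset.sum_filter, Finset.sum_range]
    rfl
  simp only [countedQuadruples, Finset.card_filter, Finset.sum_range, Fintype.sum_prod_type]
  refine Finset.sum_congr rfl fun k _ => ?_
  rw [rowPairs, Finset.sum_range]
  refine Finset.sum_congr rfl fun m _ => ?_
  rw [visitedEdges, hlt, ht, hB]
  by_cases h1 : k < τ m
  swap
  · have h1' : ¬ (k : ℕ) < τ m := h1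
    simp [h1, h1']
  have h1' : (k : ℕ) < τ m := h1
  rw [if_pos h1', Finset.mul_sum]
  refine Finset.sum_congr rfl fun m' _ => ?_
  rw [ht, edgesBelow, hlt]
  by_cases h2 : k < τ m'
  swap
  · have h2' : ¬ (k : ℕ) < τ m' := h2
    simp [h2, h2']
  have h2' : (k : ℕ) < τ m' := h2
  rw [if_pos h2']
  by_cases h3 : m' < m
  swap
  · simp [h3]
  rw [if_pos h3, Finset.mul_sum]
  refine Finset.sum_congr rfl fun i _ => ?_
  by_cases h4 : i < k
  swap
  · simp [h4]
  -- The guard in `edgesBelow` is automatic here, since i < k < τ m'.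
  have h5 : (i : ℕ) < τ m' := (show (i : ℕ) < k from h4).trans h2'
  rw [if_pos h4, if_pos h5, hB]
  simp only [h1, h2, h3, h4, true_and]
  by_cases h6 : G.Adj (e.symm k) (e.symm (τ m)) <;>
    by_cases h7 : G.Adj (e.symm i) (e.symm (τ m')) <;> simp [h6, h7]

/-- Each element is sent to the number of its predecessors, the same quantity that the ranking phase
computes. -/
theorem exists_perm_of_strict_order {n : ℕ} (r : Fin n → Fin n → Prop) (hirr : ∀ a, ¬ r a a)
    (htrans : ∀ a b c, r a b → r b c → r a c) (htot : ∀ a b, a ≠ b → r a b ∨ r b a) :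
    ∃ e : Equiv.Perm (Fin n), ∀ a b, e a < e b ↔ r a b := by
  classical
  let rank : Fin n → ℕ := fun v => (Finset.univ.filter fun u => r u v).card
  have hmono : ∀ a b, r a b → rank a < rank b := by
    intro a b hab
    apply Finset.card_lt_card
    rw [Finset.ssubset_iff_of_subset]
    · exact ⟨a, by simpa using hab, by simpa using hirr a⟩
    · intro u hu
      simp only [Finset.mem_filter, Finset.mem_univ, true_and] at hu ⊢
      exact htrans _ _ _ hu hab
  have hlt : ∀ a, rank a < n := by
    intro a
    calc rank a < (Finset.univ : Finset (Fin n)).card := by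
          apply Finset.card_lt_card
          rw [Finset.ssubset_univ_iff]
          intro h
          have := h ▸ Finset.mem_univ a
          simp [hirr] at this
      _ = n := by simp
  have hiff : ∀ a b, rank a < rank b ↔ r a b := by
    intro a b
    refine ⟨fun h => ?_, hmono a b⟩
    by_contra hab
    have hne : a ≠ b := by
      rintro rfl
      exact lt_irrefl _ h
    exact absurd h (hmono b a ((htot a b hne).resolve_left hab)).asymm
  have hinj : Function.Injective fun a => (⟨rank a, hlt a⟩ : Fin n) := by
    intro a b h
    by_contra hne
    have h : rank a = rank b := Fin.mk.inj h
    rcases htot a b hne with h' | h'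
    · exact (hmono _ _ h').ne h
    · exact (hmono _ _ h').ne h.symm
  exact ⟨Equiv.ofBijective _ (Finite.injective_iff_bijective.mp hinj), hiff⟩

/-- Division with remainder by n recovers i and j from the array position. -/
theorem ramInput_adj {n : ℕ} (G : SimpleGraph (Fin n)) (pos : Fin n → ℝ × ℝ) (i j : Fin n) :
    (ramInput G pos).iarr 0 (i * n + j) = open Classical in if G.Adj i j then 1 else 0 := by
  have : (∃ i' j' : Fin n, (i : ℕ) * n + j = i' * n + j' ∧ G.Adj i' j') ↔ G.Adj i j := by
    constructor
    · rintro ⟨i', j', h, hadj⟩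
      have h0 : 0 < n := i.pos
      have e1 := congrArg (· / n) h
      have e2 := congrArg (· % n) h
      simp only [mul_comm _ n, Nat.mul_add_div h0, Nat.div_eq_of_lt j.2,
        Nat.div_eq_of_lt j'.2, Nat.mul_add_mod, Nat.mod_eq_of_lt j.2, Nat.mod_eq_of_lt j'.2,
        add_zero] at e1 e2
      rwa [Fin.ext e1, Fin.ext e2]
    · exact fun h => ⟨i, j, rfl, h⟩
  simp only [ramInput]
  split_ifs with h1 h2 h2
  · rfl
  · exact absurd (this.mp h1.2) h2
  · exact absurd ⟨rfl, this.mpr h2⟩ h1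
  · rfl

/-- The number of steps of `countProgram b e` is at most this number times `n ^ 2 + 1`. -/
def countFactor (b : RamTest) (e : IntExpr) : ℕ := b.cost + e.cost + 105

/-- The interface to geometry: a class of graphs needs only a test for the order `e`, an expression
for `τ` and the crossing criterion. -/
theorem countProgram_counts {n : ℕ} {G : SimpleGraph (Fin n)} {pos : Fin n → ℝ × ℝ}
    {b : RamTest} {x : IntExpr} (e τ : Equiv.Perm (Fin n))
    (hb : ∀ (s : RamState) (u v : Fin n), s.rarr = (ramInput G pos).rarr →
      s.reg 3 = u → s.reg 2 = v → (b.Holds s ↔ e u < e v))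
    (hx : ∀ (s : RamState) (m : Fin n), s.reg 0 = n → s.reg 3 = m → x.eval s = τ m)
    (hcross : ∀ a b c d, G.Adj a b → G.Adj c d → e a < e b → e c < e d → e a < e c →
      (EdgesCross pos s(a, b) s(c, d) ↔ e c < e b ∧ τ.symm (e b) < τ.symm (e d)))
    (hshare : ∀ a b d, G.Adj a b → G.Adj a d → b ≠ d → e a < e b → e a < e d →
      ¬ EdgesCross pos s(a, b) s(a, d)) :
    ∃ t ≤ countFactor b x * (n ^ 2 + 1), CountsCrossingsIn (countProgram b x) 5 G pos t := by
  classical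
  let B : ℕ → ℕ → ℕ := fun i j => if h : i < n ∧ j < n then
    if G.Adj (e.symm ⟨i, h.1⟩) (e.symm ⟨j, h.2⟩) then 1 else 0 else 0
  let t : ℕ → ℕ := fun m => if h : m < n then τ ⟨m, h⟩ else 0
  have hBle : ∀ i j, B i j ≤ 1 := by
    intro i j
    simp only [B]
    split_ifs <;> simp
  have hBF : ∀ i j : Fin n, B i j = if G.Adj (e.symm i) (e.symm j) then 1 else 0 := by
    intro i j
    simp [B]
  have htF : ∀ m : Fin n, t m = τ m := by
    intro m
    simp [t]
  have hnW : n ≤ (n + 2) ^ 5 := by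
    calc n ≤ n + 2 := by omega
      _ = (n + 2) ^ 1 := (pow_one _).symm
      _ ≤ _ := Nat.pow_le_pow_right (by omega) (by norm_num)
  have hrun : RunsWithin ((n + 2) ^ 5) (countProgram b x) (ramInput G pos)
      (((b.cost + 11) * n + 17) * n + 5 + (((x.cost + 53) * n + 14) * n + 5)) fun s =>
      s.reg 1 = ∑ k ∈ Finset.range n, rowPairs B t k n := by
    refine RunsWithin.seq ((rankProgram_runs hnW e hb (by simp [ramInput])).mono le_rfl ?_)
    rintro s ⟨h0, h1, ha, hp⟩
    refine sumProgram_runs hBle ?_ ?_ ?_ ?_ h0 (by simpa [ramInput] using h1) ?_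
    · intro i hi j hj
      have ei := hp (e.symm ⟨i, hi⟩)
      have ej := hp (e.symm ⟨j, hj⟩)
      simp only [Equiv.apply_symm_apply] at ei ej
      rw [ei, ej, ha 0 (by norm_num), ramInput_adj]
      exact (hBF ⟨i, hi⟩ ⟨j, hj⟩).symm
    · intro s g0 g3
      rw [hx s ⟨s.reg 3, g3⟩ g0 rfl, ← htF]
    · intro m hm
      rw [htF ⟨m, hm⟩]
      exact Fin.is_lt _
    · intro m hm m' hm' h
      rw [htF ⟨m, hm⟩, htF ⟨m', hm'⟩] at h
      exact Fin.mk.inj (τ.injective (Fin.ext h))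
    · intro p
      rw [ha 2 (by norm_num)]
      simp [ramInput]
  obtain ⟨s, T, hT, hex, hs⟩ := hrun
  refine ⟨T, hT.trans ?_, s, hex, ?_⟩
  -- Apart from the two variable costs, the bound is 64n² + 31n + 10, and 64 + 31 + 10 = 105.
  · have h1 : n ≤ n ^ 2 := by exact Nat.le_self_pow (by norm_num) n
    unfold countFactor
    nlinarith
  · rw [hs, numCrossings_eq_card e τ hcross hshare, sum_rowPairs_eq_card e τ htF hBF]

/-! ### Convex geometric graphs -/

/-- Does the point of the vertex `k` lie to the left of the line from that of `i` to that of `j`? -/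
def leftTest (i j k : IntExpr) : RamTest :=
  .realLt
    (.mul (.sub (.load 1 j) (.load 1 i)) (.sub (.load 0 k) (.load 0 i)))
    (.mul (.sub (.load 0 j) (.load 0 i)) (.sub (.load 1 k) (.load 1 i)))

/-- Compare the vertices in registers `3` and `2` in the counterclockwise order around the convex
hull that starts at vertex `0`. -/
def convexTest : RamTest :=
  .not (.and (.not (.and (.intLt (.reg 3) (.const 1)) (.intLt (.const 0) (.reg 2))))
    (.not (leftTest (.const 0) (.reg 3) (.reg 2))))

theorem ramInput_fst {n : ℕ} (G : SimpleGraph (Fin n)) (pos : Fin n → ℝ × ℝ) (u : Fin n) :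
    (ramInput G pos).rarr 0 u = (pos u).1 := by
  simp [ramInput]

theorem ramInput_snd {n : ℕ} (G : SimpleGraph (Fin n)) (pos : Fin n → ℝ × ℝ) (u : Fin n) :
    (ramInput G pos).rarr 1 u = (pos u).2 := by
  simp [ramInput]

/-- The base vertex needs a clause of its own, because `orient` vanishes when u = o. -/
theorem convexTest_holds {n : ℕ} {G : SimpleGraph (Fin n)} {pos : Fin n → ℝ × ℝ} {s : RamState}
    (hs : s.rarr = (ramInput G pos).rarr) {o u v : Fin n} (ho : (o : ℕ) = 0)
    (hu : s.reg 3 = u) (hv : s.reg 2 = v) :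
    convexTest.Holds s ↔ (u = o ∧ v ≠ o) ∨ 0 < orient (pos o) (pos u) (pos v) := by
  have h1 : ((u : ℕ) < 1 ∧ 0 < (v : ℕ)) ↔ (u = o ∧ v ≠ o) := by
    rw [Fin.ext_iff, Ne, Fin.ext_iff, ho]
    omega
  have e0 := ramInput_fst G pos o
  have e1 := ramInput_snd G pos o
  rw [ho] at e0 e1
  simp only [convexTest, leftTest, RamTest.Holds, IntExpr.eval, RealExpr.eval, hs, hu, hv, e0, e1,
    ramInput_fst, ramInput_snd, h1, orient, sub_pos]
  tauto

/-- Sorting by angle around o is a strict total order by `orient_trans` and `orient_ne_zero`;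
`orient_pos_of_base` then extends positivity from triples that contain o to all increasing triples.
-/
theorem ConvexIndependent.exists_perm {n : ℕ} {pos : Fin n → ℝ × ℝ}
    (h : ConvexIndependent ℝ pos) {o : Fin n} (ho : (o : ℕ) = 0) :
    ∃ e : Equiv.Perm (Fin n),
      (∀ u v, e u < e v ↔ (u = o ∧ v ≠ o) ∨ 0 < orient (pos o) (pos u) (pos v)) ∧
      ∀ u v w, e u < e v → e v < e w → 0 < orient (pos u) (pos v) (pos w) := by
  have hex : ∃ e : Equiv.Perm (Fin n), ∀ u v, e u < e v ↔
      (u = o ∧ v ≠ o) ∨ 0 < orient (pos o) (pos u) (pos v) := by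
    refine exists_perm_of_strict_order _ ?_ ?_ ?_
    · rintro a (⟨h1, h2⟩ | h1)
      · exact h2 h1
      · exact (ne_of_orient_pos h1).2.2 rfl
    · rintro a b c (⟨rfl, h2⟩ | h1) (⟨rfl, h4⟩ | h3)
      · exact Or.inl ⟨rfl, h4⟩
      · exact Or.inl ⟨rfl, (ne_of_orient_pos h3).2.1.symm⟩
      · exact absurd rfl (ne_of_orient_pos h1).2.1
      · exact Or.inr (h.orient_trans h1 h3)
    · intro a b hab
      by_cases ha : a = o
      · exact Or.inl (Or.inl ⟨ha, fun hb => hab (ha.trans hb.symm)⟩)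
      by_cases hb : b = o
      · exact Or.inr (Or.inl ⟨hb, ha⟩)
      rcases lt_or_gt_of_ne (h.orient_ne_zero (Ne.symm ha) (Ne.symm hb) hab) with h1 | h1
      · exact Or.inr (Or.inr (by rw [orient_swap]; linarith))
      · exact Or.inl (Or.inr h1)
  obtain ⟨e, he⟩ := hex
  refine ⟨e, he, ?_⟩
  intro u v w huv hvw
  have hvo : v ≠ o := by
    rcases (he u v).mp huv with h1 | h1
    · exact h1.2
    · exact (ne_of_orient_pos h1).2.1.symm
  have h2 := ((he v w).mp hvw).resolve_left fun h => hvo h.1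
  rcases (he u v).mp huv with ⟨rfl, -⟩ | h1
  · exact h2
  · exact h.orient_pos_of_base h1 h2

/-- Chords of a convex polygon cross iff their ends alternate. The place of b relative to c and d
determines the signs that decide the criterion. -/
theorem edgesCross_iff_of_convex_order {n : ℕ} {pos : Fin n → ℝ × ℝ} {e : Equiv.Perm (Fin n)}
    (he : ∀ u v w, e u < e v → e v < e w → 0 < orient (pos u) (pos v) (pos w))
    {a b c d : Fin n} (hab : e a < e b) (hcd : e c < e d) (hac : e a < e c) :
    EdgesCross pos s(a, b) s(c, d) ↔ e c < e b ∧ e b < e d := by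
  rw [edgesCross_mk]
  have acd := he a c d hac hcd
  have cda : 0 < orient (pos c) (pos d) (pos a) := by rwa [orient_rotate]
  rcases lt_trichotomy (e b) (e c) with hbc | hbc | hbc
  · have abc := he a b c hab hbc
    have abd := he a b d hab (hbc.trans hcd)
    rw [openSegment_inter_nonempty_iff (Or.inl abc.ne') (Or.inl cda.ne')]
    exact iff_of_false (fun h => absurd h.1 (mul_pos abc abd).asymm) fun h => absurd h.1 hbc.asymm
  · obtain rfl := e.injective hbc
    rw [openSegment_inter_nonempty_iff (Or.inr acd.ne') (Or.inl cda.ne')]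
    simp [orient_self_right]
  have abc : orient (pos a) (pos b) (pos c) < 0 := by
    have := he a c b hac hbc
    rw [orient_swap]
    linarith
  rw [openSegment_inter_nonempty_iff (Or.inl abc.ne) (Or.inl cda.ne')]
  rcases lt_trichotomy (e b) (e d) with hbd | hbd | hbd
  · have abd := he a b d hab hbd
    have cdb : orient (pos c) (pos d) (pos b) < 0 := by
      have := he c b d hbc hbd
      rw [orient_swap]
      linarith
    exact iff_of_true ⟨mul_neg_of_neg_of_pos abc abd, mul_neg_of_pos_of_neg cda cdb⟩ ⟨hbc, hbd⟩
  · obtain rfl := e.injective hbd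
    simp [orient_self_right]
  · have abd : orient (pos a) (pos b) (pos d) < 0 := by
      have := he a d b (hac.trans hcd) hbd
      rw [orient_swap]
      linarith
    exact iff_of_false (fun h => absurd h.1 (mul_pos_of_neg_of_neg abc abd).asymm)
      fun h => absurd h.2 hbd.asymm

theorem not_edgesCross_of_common {V : Type*} {pos : V → ℝ × ℝ} {a b d : V}
    (h : orient (pos a) (pos b) (pos d) ≠ 0) : ¬ EdgesCross pos s(a, b) s(a, d) := by
  rw [edgesCross_mk, openSegment_inter_nonempty_iff (Or.inr h)
    (Or.inr (by rwa [orient_swap, neg_ne_zero]))]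
  simp [orient_self_outer]

theorem convexProgram_counts {n : ℕ} (G : SimpleGraph (Fin n)) {pos : Fin n → ℝ × ℝ}
    (h : ConvexIndependent ℝ pos) :
    ∃ t ≤ countFactor convexTest (.reg 3) * (n ^ 2 + 1),
      CountsCrossingsIn (countProgram convexTest (.reg 3)) 5 G pos t := by
  -- Without vertices there is no base vertex for the angular order.
  rcases Nat.eq_zero_or_pos n with rfl | hn
  · exact countProgram_counts (Equiv.refl _) (Equiv.refl _) (fun _ u => u.elim0)
      (fun _ u => u.elim0) (fun a => a.elim0) (fun a => a.elim0)
  obtain ⟨e, he, he'⟩ := h.exists_perm (o := ⟨0, hn⟩) rfl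
  refine countProgram_counts e (Equiv.refl _) ?_ ?_ ?_ ?_
  · intro s u v hs hu hv
    rw [convexTest_holds hs (o := ⟨0, hn⟩) rfl hu hv, he]
  · intro s m _ h3
    simpa [IntExpr.eval] using h3
  · intro a b c d _ _ hab hcd hac
    exact edgesCross_iff_of_convex_order he' hab hcd hac
  · intro a b d hab had hbd _ _
    exact not_edgesCross_of_common (h.orient_ne_zero hab.ne had.ne hbd)

/-! ### Layered graphs -/

/-- Compare the vertices in registers `3` and `2` by height, then from left to right. -/
def layeredTest : RamTest :=
  .not (.and (.not (.realLt (.load 1 (.reg 3)) (.load 1 (.reg 2))))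
    (.not (.and (.not (.realLt (.load 1 (.reg 2)) (.load 1 (.reg 3))))
      (.realLt (.load 0 (.reg 3)) (.load 0 (.reg 2))))))

theorem layeredTest_holds {n : ℕ} {G : SimpleGraph (Fin n)} {pos : Fin n → ℝ × ℝ} {s : RamState}
    (hs : s.rarr = (ramInput G pos).rarr) {u v : Fin n} (hu : s.reg 3 = u) (hv : s.reg 2 = v) :
    layeredTest.Holds s ↔
      (pos u).2 < (pos v).2 ∨ ((pos u).2 = (pos v).2 ∧ (pos u).1 < (pos v).1) := by
  simp only [layeredTest, RamTest.Holds, IntExpr.eval, RealExpr.eval, hs, hu, hv,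
    ramInput_fst, ramInput_snd]
  rcases lt_trichotomy (pos u).2 (pos v).2 with h | h | h
  · simp [h]
  · simp [h]
  · simp [h, h.le, h.ne']

theorem exists_perm_of_height {n : ℕ} {pos : Fin n → ℝ × ℝ} (h : Function.Injective pos) :
    ∃ e : Equiv.Perm (Fin n), ∀ u v, e u < e v ↔
      (pos u).2 < (pos v).2 ∨ ((pos u).2 = (pos v).2 ∧ (pos u).1 < (pos v).1) := by
  refine exists_perm_of_strict_order _ ?_ ?_ ?_
  · rintro a (h | h)
    exacts [lt_irrefl _ h, lt_irrefl _ h.2]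
  · rintro a b c (h1 | ⟨h1, h2⟩) (h3 | ⟨h3, h4⟩)
    · exact Or.inl (h1.trans h3)
    · exact Or.inl (h3 ▸ h1)
    · exact Or.inl (h1 ▸ h3)
    · exact Or.inr ⟨h1.trans h3, h2.trans h4⟩
  · intro a b hab
    rcases lt_trichotomy (pos a).2 (pos b).2 with h1 | h1 | h1
    · exact Or.inl (Or.inl h1)
    · rcases lt_trichotomy (pos a).1 (pos b).1 with h2 | h2 | h2
      · exact Or.inl (Or.inr ⟨h1, h2⟩)
      · exact absurd (h (Prod.ext h2 h1)) hab
      · exact Or.inr (Or.inr ⟨h1.symm, h2⟩)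
    · exact Or.inr (Or.inl h1)

theorem snd_mem_Ioo_of_mem_openSegment {a b p : ℝ × ℝ} (hab : a.2 < b.2)
    (hp : p ∈ openSegment ℝ a b) : p.2 ∈ Set.Ioo a.2 b.2 := by
  obtain ⟨s, t, hs, ht, hst, rfl⟩ := hp
  obtain rfl : s = 1 - t := by linarith
  simp only [Prod.snd_add, Prod.smul_snd, smul_eq_mul]
  constructor <;> nlinarith

/-- The open segments lie in disjoint open horizontal strips. -/
theorem not_edgesCross_of_height {V : Type*} {pos : V → ℝ × ℝ} {a b c d : V}
    (hab : (pos a).2 < (pos b).2) (hcd : (pos c).2 < (pos d).2) (hbc : (pos b).2 ≤ (pos c).2) :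
    ¬ EdgesCross pos s(a, b) s(c, d) := by
  rintro ⟨p, hp, hq⟩
  have h1 := (snd_mem_Ioo_of_mem_openSegment hab hp).2
  have h2 := (snd_mem_Ioo_of_mem_openSegment hcd hq).1
  linarith

theorem orient_of_snd_eq {a b c : ℝ × ℝ} (h : a.2 = c.2) :
    orient a b c = -((b.2 - a.2) * (c.1 - a.1)) := by
  unfold orient
  rw [h]
  ring

theorem orient_of_snd_eq' {a b c : ℝ × ℝ} (h : b.2 = c.2) :
    orient a b c = (b.2 - a.2) * (b.1 - c.1) := by
  unfold orient
  rw [h]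
  ring

/-- Two edges between the same two horizontal lines. -/
theorem edgesCross_iff_of_bilayer {V : Type*} {pos : V → ℝ × ℝ} {a b c d : V}
    (hab : (pos a).2 < (pos b).2) (hac : (pos a).2 = (pos c).2) (hbd : (pos b).2 = (pos d).2)
    (hx : (pos a).1 < (pos c).1) :
    EdgesCross pos s(a, b) s(c, d) ↔ (pos d).1 < (pos b).1 := by
  have abc : orient (pos a) (pos b) (pos c) < 0 := by
    rw [orient_of_snd_eq hac]
    have := mul_pos (sub_pos.mpr hab) (sub_pos.mpr hx)
    linarith
  have cda : 0 < orient (pos c) (pos d) (pos a) := by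
    rw [orient_of_snd_eq hac.symm, ← hbd, ← hac]
    have := mul_pos (sub_pos.mpr hab) (sub_pos.mpr hx)
    linarith
  rw [edgesCross_mk, openSegment_inter_nonempty_iff (Or.inl abc.ne) (Or.inl cda.ne'),
    orient_of_snd_eq' hbd, orient_of_snd_eq' hbd.symm, ← hbd, ← hac]
  have hh := sub_pos.mpr hab
  constructor
  · rintro ⟨h1, -⟩
    by_contra hc
    exact absurd h1 (not_lt.mpr (mul_nonneg_of_nonpos_of_nonpos abc.le
      (mul_nonpos_of_nonneg_of_nonpos hh.le (by linarith))))
  · intro h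
    exact ⟨mul_neg_of_neg_of_pos abc (mul_pos hh (by linarith)),
      mul_neg_of_pos_of_neg cda (mul_neg_of_pos_of_neg hh (by linarith))⟩

section Layering

variable {V : Type*} {G : SimpleGraph V} {pos : V → ℝ × ℝ} {r : ℕ} {layer : V → Fin r}
  {y : Fin r → ℝ}

theorem IsLayering.height_lt_iff (h : IsLayering G pos layer y) {u v : V} :
    (pos u).2 < (pos v).2 ↔ (layer u : ℕ) < layer v := by
  rw [h.height, h.height, h.strictMono.lt_iff_lt, Fin.lt_def]

theorem IsLayering.height_eq_iff (h : IsLayering G pos layer y) {u v : V} :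
    (pos u).2 = (pos v).2 ↔ (layer u : ℕ) = layer v := by
  rw [h.height, h.height, h.strictMono.injective.eq_iff, Fin.ext_iff]

theorem IsLayering.height_le_iff (h : IsLayering G pos layer y) {u v : V} :
    (pos u).2 ≤ (pos v).2 ↔ (layer u : ℕ) ≤ layer v := by
  rw [h.height, h.height, h.strictMono.le_iff_le, Fin.le_def]

end Layering

theorem layeredProgram_counts {n : ℕ} {G : SimpleGraph (Fin n)} {pos : Fin n → ℝ × ℝ}
    (h : IsLayered G pos) :
    ∃ t ≤ countFactor layeredTest (.sub (.sub (.reg 0) (.const 1)) (.reg 3)) * (n ^ 2 + 1),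
      CountsCrossingsIn
        (countProgram layeredTest (.sub (.sub (.reg 0) (.const 1)) (.reg 3))) 5 G pos t := by
  obtain ⟨r, layer, y, h⟩ := h
  obtain ⟨e, he⟩ := exists_perm_of_height h.injective
  have hstep : ∀ a b, G.Adj a b → e a < e b → (layer a : ℕ) + 1 = layer b := by
    intro a b hab hlt
    rcases h.adj a b hab with h1 | h1
    · exact h1
    · rw [he, h.height_lt_iff, h.height_eq_iff] at hlt
      omega
  refine countProgram_counts e Fin.revPerm ?_ ?_ ?_ ?_
  · intro s u v hs hu hv
    rw [layeredTest_holds hs hu hv, he]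
  -- The visiting order is m ↦ n - 1 - m; the truncated subtraction is exact because m < n.
  · intro s m h0 h3
    simp only [IntExpr.eval, h0, h3, Fin.revPerm_apply, Fin.val_rev]
    omega
  · intro a b c d hab hcd hab' hcd' hac
    have l1 := hstep a b hab hab'
    have l2 := hstep c d hcd hcd'
    have hab2 : (pos a).2 < (pos b).2 := h.height_lt_iff.mpr (by omega)
    have hcd2 : (pos c).2 < (pos d).2 := h.height_lt_iff.mpr (by omega)
    rw [Fin.revPerm_symm, Fin.revPerm_apply, Fin.revPerm_apply, Fin.rev_lt_rev]
    rcases (he a c).mp hac with h1 | ⟨h1, h2⟩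
    · rw [h.height_lt_iff] at h1
      -- If a lies in a lower layer than c, then b lies in a lower layer than d, so d cannot precede
      -- b in `e`.
      refine iff_of_false (not_edgesCross_of_height hab2 hcd2 (h.height_le_iff.mpr (by omega))) ?_
      rintro ⟨-, h3⟩
      rw [he, h.height_lt_iff, h.height_eq_iff] at h3
      omega
    · have hac2 := h.height_eq_iff.mp h1
      have hbd : (pos b).2 = (pos d).2 := h.height_eq_iff.mpr (by omega)
      have hcb : e c < e b := (he c b).mpr (Or.inl (h1 ▸ hab2))
      rw [edgesCross_iff_of_bilayer hab2 h1 hbd h2, he d b]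
      simp [hcb, hbd]
  · intro a b d hab had hbd hab' had'
    have l1 := hstep a b hab hab'
    have l2 := hstep a d had had'
    have hab2 : (pos a).2 < (pos b).2 := h.height_lt_iff.mpr (by omega)
    have hbd2 : (pos b).2 = (pos d).2 := h.height_eq_iff.mpr (by omega)
    apply not_edgesCross_of_common
    rw [orient_of_snd_eq' hbd2]
    exact mul_ne_zero (sub_pos.mpr hab2).ne'
      (sub_ne_zero.mpr fun h' => hbd (h.injective (Prod.ext h' hbd2)))

/-! ### Supporting lines -/

theorem exists_ne_zero_map_eq_zero (f : ℝ × ℝ →ₗ[ℝ] ℝ) : ∃ d : ℝ × ℝ, d ≠ 0 ∧ f d = 0 := by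
  by_cases h : f (1, 0) = 0
  · exact ⟨(1, 0), by simp, h⟩
  · refine ⟨(f (0, 1), -f (1, 0)), by simp [h], ?_⟩
    have : ((f (0, 1), -f (1, 0)) : ℝ × ℝ) = f (0, 1) • (1, 0) + (-f (1, 0)) • (0, 1) := by
      ext <;> simp
    rw [this, map_add, map_smul, map_smul]
    simp only [smul_eq_mul]
    ring

/-- An open half-plane stays convex when a single boundary point is added. Such a set contains the
hull of all vertices and meets its boundary line only in p. -/
theorem convex_insert_halfSpace (f : ℝ × ℝ →ₗ[ℝ] ℝ) (p : ℝ × ℝ) :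
    Convex ℝ {q | q = p ∨ f p < f q} := by
  intro x hx z hz a b ha hb hab
  rcases ha.eq_or_lt with rfl | ha
  · obtain rfl : b = 1 := by linarith
    simpa using hz
  rcases hb.eq_or_lt with rfl | hb
  · obtain rfl : a = 1 := by linarith
    simpa using hx
  obtain rfl : a = 1 - b := by linarith
  simp only [Set.mem_ofPred_eq, map_add, map_smul, smul_eq_mul] at hx hz ⊢
  rcases hx with rfl | hx <;> rcases hz with rfl | hz
  · left
    rw [← add_smul]
    simp
  · right; nlinarith
  · right; nlinarith
  · right; nlinarith

theorem ConvexIndependent.exists_openRay_disjoint {V : Type*} [Finite V] {pos : V → ℝ × ℝ}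
    (h : ConvexIndependent ℝ pos) (u : V) : ∃ d : ℝ × ℝ, d ≠ 0 ∧
      Disjoint (openRay (pos u) d) (convexHull ℝ (Set.range pos)) ∧
      Disjoint (openRay (pos u) (-d)) (convexHull ℝ (Set.range pos)) := by
  have hu : pos u ∉ convexHull ℝ (pos '' {u}ᶜ) := fun hc => h _ _ hc rfl
  -- The hull of finitely many points is compact, hence closed, so the separation is strict; d is
  -- then taken in the kernel of f.
  obtain ⟨f, c, hf, hf'⟩ := geometric_hahn_banach_point_closed (convex_convexHull ℝ (pos '' {u}ᶜ))
    ((Set.toFinite (pos '' {u}ᶜ)).isCompact_convexHull ℝ).isClosed hu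
  have hull : convexHull ℝ (Set.range pos) ⊆ {q | q = pos u ∨ f (pos u) < f q} := by
    apply convexHull_min _ (convex_insert_halfSpace (f : ℝ × ℝ →ₗ[ℝ] ℝ) (pos u))
    rintro _ ⟨v, rfl⟩
    by_cases hv : v = u
    · exact Or.inl (by rw [hv])
    · exact Or.inr (hf.trans (hf' _ (subset_convexHull _ _ ⟨v, hv, rfl⟩)))
  have key : ∀ d : ℝ × ℝ, d ≠ 0 → f d = 0 →
      Disjoint (openRay (pos u) d) (convexHull ℝ (Set.range pos)) := by
    intro d hd hfd
    rw [Set.disjoint_left]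
    rintro _ ⟨t, ht, rfl⟩ hq
    rcases hull hq with h1 | h1
    · have : t • d = 0 := by simpa using h1
      rcases smul_eq_zero.mp this with h2 | h2
      exacts [ht.ne' h2, hd h2]
    · simp [hfd] at h1
  obtain ⟨d, hd, hfd⟩ := exists_ne_zero_map_eq_zero (f : ℝ × ℝ →ₗ[ℝ] ℝ)
  have hfd : f d = 0 := hfd
  exact ⟨d, hd, key d hd hfd, key (-d) (by simpa using hd) (by simp [hfd])⟩

theorem rayCount_eq_zero {V : Type*} (G : SimpleGraph V) {pos : V → ℝ × ℝ} {p d : ℝ × ℝ}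
    (h : Disjoint (openRay p d) (convexHull ℝ (Set.range pos))) : rayCount G pos p d = 0 := by
  have : {e : Sym2 V | e ∈ G.edgeSet ∧ (openRay p d ∩ edgeSegment pos e).Nonempty} = ∅ := by
    rw [Set.eq_empty_iff_forall_notMem]
    rintro e ⟨-, q, hq, hq'⟩
    refine Set.disjoint_left.mp h hq ?_
    induction e with
    | h a b =>
      exact segment_subset_convexHull (Set.mem_range_self a) (Set.mem_range_self b) hq'
  rw [rayCount, this, Set.ncard_empty]

/-- If v is the unique minimiser of a linear functional, the hull of any other vertices lies in an
open half-plane that misses v. -/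
theorem convexIndependent_of_supporting {V : Type*} {pos : V → ℝ × ℝ}
    (h : ∀ v, ∃ α β : ℝ, ∀ w ≠ v,
      α * (pos v).1 + β * (pos v).2 < α * (pos w).1 + β * (pos w).2) :
    ConvexIndependent ℝ pos := by
  intro s x hx
  by_contra hxs
  obtain ⟨α, β, hαβ⟩ := h x
  let f : ℝ × ℝ →ₗ[ℝ] ℝ := α • LinearMap.fst ℝ ℝ ℝ + β • LinearMap.snd ℝ ℝ ℝ
  have hconv : Convex ℝ {q | f (pos x) < f q} := convex_halfSpace_gt f.isLinear _
  have hsub : pos '' s ⊆ {q | f (pos x) < f q} := by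
    rintro _ ⟨w, hw, rfl⟩
    exact hαβ w fun h => hxs (h ▸ hw)
  exact lt_irrefl (f (pos x)) (convexHull_min hsub hconv hx)

/-! ### Bilayer subgraphs -/

theorem mem_edgeSet_bilayerGraph {V : Type*} {G : SimpleGraph V} {r : ℕ} {layer : V → Fin r}
    {i : ℕ} (e : Sym2 (bilayer layer i)) :
    e ∈ (bilayerGraph G layer i).edgeSet ↔ e.map Subtype.val ∈ G.edgeSet := by
  induction e with
  | h a b => rfl

theorem edgesCross_bilayerPos {V : Type*} {pos : V → ℝ × ℝ} {r : ℕ} {layer : V → Fin r}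
    {i : ℕ} (e f : Sym2 (bilayer layer i)) :
    EdgesCross (bilayerPos pos layer i) e f ↔
      EdgesCross pos (e.map Subtype.val) (f.map Subtype.val) := by
  induction e with
  | h a b =>
    induction f with
    | h c d => rfl

theorem Sym2.exists_map_val {V : Type*} {s : Set V} {e : Sym2 V} (h : ∀ v ∈ e, v ∈ s) :
    ∃ e' : Sym2 s, e'.map Subtype.val = e := by
  induction e with
  | h a b => exact ⟨s(⟨a, h a (by simp)⟩, ⟨b, h b (by simp)⟩), rfl⟩

/-- The crossing pairs of edges with all endpoints in the set `s`. -/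
def crossingPairsIn {V : Type*} (G : SimpleGraph V) (pos : V → ℝ × ℝ) (s : Set V) :
    Set (Sym2 (Sym2 V)) :=
  {p | ∃ e f : Sym2 V, p = s(e, f) ∧ (e ∈ G.edgeSet ∧ f ∈ G.edgeSet ∧ e ≠ f ∧
    EdgesCross pos e f) ∧ (∀ v ∈ e, v ∈ s) ∧ ∀ v ∈ f, v ∈ s}

/-- Moves the count from the subtype to the whole vertex set, where the bilayers can be compared as
subsets of one set of pairs. -/
theorem numCrossings_bilayerGraph {V : Type*} (G : SimpleGraph V) (pos : V → ℝ × ℝ) {r : ℕ}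
    (layer : V → Fin r) (i : ℕ) :
    numCrossings (bilayerGraph G layer i) (bilayerPos pos layer i) =
      (crossingPairsIn G pos (bilayer layer i)).ncard := by
  have hinj : Function.Injective (Sym2.map (Subtype.val : bilayer layer i → V)) :=
    Sym2.map.injective Subtype.val_injective
  rw [numCrossings, ← Set.ncard_image_of_injective _ (Sym2.map.injective hinj)]
  congr 1
  ext p
  constructor
  · rintro ⟨_, ⟨e, f, rfl, he, hf, hef, hc⟩, rfl⟩
    refine ⟨_, _, rfl, ⟨(mem_edgeSet_bilayerGraph e).mp he, (mem_edgeSet_bilayerGraph f).mp hf,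
      hinj.ne hef, (edgesCross_bilayerPos e f).mp hc⟩, ?_, ?_⟩
    · intro v hv
      obtain ⟨w, -, rfl⟩ := Sym2.mem_map.mp hv
      exact w.2
    · intro v hv
      obtain ⟨w, -, rfl⟩ := Sym2.mem_map.mp hv
      exact w.2
  · rintro ⟨_, _, rfl, ⟨he, hf, hef, hc⟩, h1, h2⟩
    obtain ⟨e, rfl⟩ := Sym2.exists_map_val h1
    obtain ⟨f, rfl⟩ := Sym2.exists_map_val h2
    exact ⟨s(e, f), ⟨e, f, rfl, (mem_edgeSet_bilayerGraph e).mpr he,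
      (mem_edgeSet_bilayerGraph f).mpr hf, fun h => hef (by rw [h]),
      (edgesCross_bilayerPos e f).mpr hc⟩, rfl⟩

section Layering

variable {V : Type*} {G : SimpleGraph V} {pos : V → ℝ × ℝ} {r : ℕ} {layer : V → Fin r}
  {y : Fin r → ℝ}

theorem IsLayering.exists_upward (h : IsLayering G pos layer y) {e : Sym2 V}
    (he : e ∈ G.edgeSet) : ∃ a b, e = s(a, b) ∧ (layer a : ℕ) + 1 = layer b := by
  induction e with
  | h a b =>
    rcases h.adj a b he with h1 | h1
    · exact ⟨a, b, rfl, h1⟩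
    · exact ⟨b, a, Sym2.eq_swap, h1⟩

theorem IsLayering.numCrossings_eq_sum [Finite V] (h : IsLayering G pos layer y) :
    numCrossings G pos = ∑ i ∈ Finset.range (r - 1),
      numCrossings (bilayerGraph G layer i) (bilayerPos pos layer i) := by
  classical
  have : Fintype V := Fintype.ofFinite V
  simp only [numCrossings_bilayerGraph, Set.ncard_eq_toFinset_card']
  rw [← Finset.card_biUnion, numCrossings, ← Set.ncard_coe_finset]
  · congr 1
    ext p
    simp only [Finset.coe_biUnion, Set.mem_iUnion, Finset.coe_range, Set.mem_Iio, Set.coe_toFinset]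
    constructor
    · rintro ⟨e, f, rfl, he, hf, hef, hc⟩
      obtain ⟨a, b, rfl, hab⟩ := h.exists_upward he
      obtain ⟨c, d, rfl, hcd⟩ := h.exists_upward hf
      have hab2 : (pos a).2 < (pos b).2 := h.height_lt_iff.mpr (by omega)
      have hcd2 : (pos c).2 < (pos d).2 := h.height_lt_iff.mpr (by omega)
      -- Edges whose lower ends are in different layers lie in different strips and cannot cross.
      have hac : (layer a : ℕ) = layer c := by
        rcases lt_trichotomy (layer a : ℕ) (layer c) with h1 | h1 | h1
        · exact absurd hc
            (not_edgesCross_of_height hab2 hcd2 (h.height_le_iff.mpr (by omega)))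
        · exact h1
        · exact absurd hc.symm
            (not_edgesCross_of_height hcd2 hab2 (h.height_le_iff.mpr (by omega)))
      refine ⟨layer a, ?_, _, _, rfl, ⟨he, hf, hef, hc⟩, ?_, ?_⟩
      · have := (layer b).2
        omega
      · intro v hv
        rcases Sym2.mem_iff.mp hv with rfl | rfl
        exacts [Or.inl rfl, Or.inr hab.symm]
      · intro v hv
        rcases Sym2.mem_iff.mp hv with rfl | rfl
        exacts [Or.inl hac.symm, Or.inr (hcd.symm.trans (by rw [hac]))]
    · rintro ⟨i, -, e, f, rfl, h1, -⟩
      exact ⟨e, f, rfl, h1⟩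
  · intro i _ j _ hij
    -- Disjointness holds because the two layers joined by an edge determine the index of its
    -- bilayer.
    simp only [Function.onFun, Set.disjoint_toFinset]
    rw [Set.disjoint_left]
    rintro _ ⟨e, f, rfl, ⟨he, -⟩, h1, -⟩ ⟨e', f', hp, -, h2, h3⟩
    have h4 : ∀ v ∈ e, v ∈ bilayer layer j := by
      rcases Sym2.eq_iff.mp hp with ⟨rfl, -⟩ | ⟨rfl, -⟩
      exacts [h2, h3]
    obtain ⟨a, b, rfl, hab⟩ := h.exists_upward he
    have m1 := h1 a (by simp)
    have m2 := h1 b (by simp)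
    have m3 := h4 a (by simp)
    have m4 := h4 b (by simp)
    simp only [bilayer, Set.mem_ofPred_eq] at m1 m2 m3 m4
    omega

end Layering

/-! ### Perturbation of two layers to convex position -/

theorem mul_neg_iff_of_same_sign {x x' z z' : ℝ} (hx : (x = 0 ∧ x' = 0) ∨ 0 < x * x')
    (hz : (z = 0 ∧ z' = 0) ∨ 0 < z * z') : x' * z' < 0 ↔ x * z < 0 := by
  rcases hx with ⟨rfl, rfl⟩ | hx
  · simp
  rcases hz with ⟨rfl, rfl⟩ | hz
  · simp
  have h : 0 < (x * z) * (x' * z') := by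
    have := mul_pos hx hz
    linarith
  constructor
  · intro h1
    by_contra h2
    exact absurd h (not_lt.mpr (mul_nonpos_of_nonneg_of_nonpos (not_lt.mp h2) h1.le))
  · intro h1
    by_contra h2
    exact absurd h (not_lt.mpr (mul_nonpos_of_nonpos_of_nonneg h1.le (not_lt.mp h2)))

/-- Nonzero orientations keep their sign by assumption, and those excepted in `hc`, `hd`, `ha`, `hb`
have a repeated vertex and vanish in both drawings. -/
theorem edgesCross_iff_of_same_sign {V : Type*} {pos pos' : V → ℝ × ℝ} {a b c d : V}
    (hne : orient (pos a) (pos b) (pos c) ≠ 0 ∨ orient (pos a) (pos b) (pos d) ≠ 0)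
    (hne' : orient (pos c) (pos d) (pos a) ≠ 0 ∨ orient (pos c) (pos d) (pos b) ≠ 0)
    (hs : ∀ u v w, orient (pos u) (pos v) (pos w) ≠ 0 →
      0 < orient (pos u) (pos v) (pos w) * orient (pos' u) (pos' v) (pos' w))
    (hc : a = c ∨ orient (pos a) (pos b) (pos c) ≠ 0)
    (hd : b = d ∨ orient (pos a) (pos b) (pos d) ≠ 0)
    (ha : a = c ∨ orient (pos c) (pos d) (pos a) ≠ 0)
    (hb : b = d ∨ orient (pos c) (pos d) (pos b) ≠ 0) :
    EdgesCross pos' s(a, b) s(c, d) ↔ EdgesCross pos s(a, b) s(c, d) := by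
  have hs' : ∀ u v w, orient (pos u) (pos v) (pos w) ≠ 0 →
      orient (pos' u) (pos' v) (pos' w) ≠ 0 := by
    intro u v w h h0
    have := hs u v w h
    simp [h0] at this
  rw [edgesCross_mk, edgesCross_mk, openSegment_inter_nonempty_iff hne hne',
    openSegment_inter_nonempty_iff (hne.imp (hs' _ _ _) (hs' _ _ _))
      (hne'.imp (hs' _ _ _) (hs' _ _ _))]
  refine and_congr (mul_neg_iff_of_same_sign (hc.imp ?_ (hs _ _ _)) (hd.imp ?_ (hs _ _ _)))
    (mul_neg_iff_of_same_sign (ha.imp ?_ (hs _ _ _)) (hb.imp ?_ (hs _ _ _))) <;>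
  · rintro rfl
    simp [orient_self_outer, orient_self_right]

theorem exists_convex_perturbation {V : Type*} [Finite V] {G : SimpleGraph V} {pos : V → ℝ × ℝ}
    (hpos : Function.Injective pos) {y₀ y₁ : ℝ} (hy : y₀ < y₁)
    (hlayer : ∀ v, (pos v).2 = y₀ ∨ (pos v).2 = y₁)
    (hadj : ∀ u v, G.Adj u v → (pos u).2 ≠ (pos v).2) {ε : ℝ} (hε : 0 < ε) :
    ∃ pos' : V → ℝ × ℝ, ConvexIndependent ℝ pos' ∧ (∀ v, dist (pos' v) (pos v) < ε) ∧
      ∀ e ∈ G.edgeSet, ∀ f ∈ G.edgeSet, (EdgesCross pos' e f ↔ EdgesCross pos e f) := by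
  classical
  let σ : V → ℝ := fun v => if (pos v).2 = y₀ then 1 else -1
  -- The lower line is bent into y₀ + δx², the upper one into y₁ - δx².
  let q : ℝ → V → ℝ × ℝ := fun δ v => ((pos v).1, (pos v).2 + δ * (σ v * (pos v).1 ^ 2))
  have hσ : ∀ v, ((pos v).2 = y₀ ∧ σ v = 1) ∨ ((pos v).2 = y₁ ∧ σ v = -1) := by
    intro v
    rcases hlayer v with h | h
    · exact Or.inl ⟨h, by simp [σ, h]⟩
    · exact Or.inr ⟨h, by simp [σ, h, hy.ne']⟩
  have hq0 : ∀ v, q 0 v = pos v := fun v => by simp [q]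
  have hev : ∀ g h : ℝ → ℝ, Continuous g → Continuous h → g 0 < h 0 →
      ∀ᶠ δ in nhdsWithin 0 (Set.Ioi 0), g δ < h δ := fun g h hg hh h0 =>
    ((hg.tendsto 0).eventually_lt (hh.tendsto 0) h0).filter_mono nhdsWithin_le_nhds
  -- The functional comes from the tangent to the parabola at v. At δ = 0 it is `σ v` times the
  -- height, which strictly separates the two layers; this persists for small δ.
  have h1 : ∀ᶠ δ in nhdsWithin (0 : ℝ) (Set.Ioi 0), ∀ v w, (pos v).2 ≠ (pos w).2 →
      -2 * δ * (pos v).1 * (q δ v).1 + σ v * (q δ v).2 <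
        -2 * δ * (pos v).1 * (q δ w).1 + σ v * (q δ w).2 := by
    simp only [Filter.eventually_all]
    intro v w hvw
    refine hev _ _ (by fun_prop) (by fun_prop) ?_
    rw [hq0, hq0]
    rcases hσ v with ⟨e1, e2⟩ | ⟨e1, e2⟩ <;> rcases hσ w with ⟨e3, -⟩ | ⟨e3, -⟩
    · exact absurd (e1.trans e3.symm) hvw
    · rw [e1, e2, e3]; linarith
    · rw [e1, e2, e3]; linarith
    · exact absurd (e1.trans e3.symm) hvw
  have h2 : ∀ᶠ δ in nhdsWithin (0 : ℝ) (Set.Ioi 0), ∀ v, dist (q δ v) (pos v) < ε := by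
    simp only [Filter.eventually_all]
    intro v
    refine hev _ _ (by fun_prop) continuous_const ?_
    rwa [hq0, dist_self]
  have h3 : ∀ᶠ δ in nhdsWithin (0 : ℝ) (Set.Ioi 0), ∀ u v w,
      orient (pos u) (pos v) (pos w) ≠ 0 →
        0 < orient (pos u) (pos v) (pos w) * orient (q δ u) (q δ v) (q δ w) := by
    simp only [Filter.eventually_all]
    intro u v w h
    refine hev _ _ continuous_const (by unfold orient; fun_prop) ?_
    simp only [hq0]
    exact mul_self_pos.mpr h
  obtain ⟨δ, ⟨⟨h1, h2⟩, h3⟩, hδ⟩ := (((h1.and h2).and h3).and self_mem_nhdsWithin).exists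
  have hδ : 0 < δ := hδ
  refine ⟨q δ, convexIndependent_of_supporting fun v => ⟨-2 * δ * (pos v).1, σ v, ?_⟩, h2, ?_⟩
  · intro w hwv
    -- Within one layer the functional at w exceeds its value at v by δ times the square of the
    -- difference of abscissas.
    by_cases hvw : (pos v).2 = (pos w).2
    · have hσvw : σ w = σ v := by simp only [σ, hvw]
      have hσ2 : σ v * σ v = 1 := by
        rcases hσ v with ⟨-, e⟩ | ⟨-, e⟩ <;> rw [e] <;> norm_num
      have hx : (pos w).1 - (pos v).1 ≠ 0 :=
        sub_ne_zero.mpr fun h => hwv (hpos (Prod.ext h hvw.symm))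
      have hsq := mul_pos hδ (mul_self_pos.mpr hx)
      simp only [q, hσvw, hvw]
      have e1 : σ v * ((pos w).2 + δ * (σ v * (pos v).1 ^ 2)) =
          σ v * (pos w).2 + δ * (pos v).1 ^ 2 := by
        linear_combination δ * (pos v).1 ^ 2 * hσ2
      have e2 : σ v * ((pos w).2 + δ * (σ v * (pos w).1 ^ 2)) =
          σ v * (pos w).2 + δ * (pos w).1 ^ 2 := by
        linear_combination δ * (pos w).1 ^ 2 * hσ2
      rw [e1, e2]
      linarith
    · exact h1 v w hvw
  · have hor : ∀ e ∈ G.edgeSet, ∃ a b, e = s(a, b) ∧ (pos a).2 = y₀ ∧ (pos b).2 = y₁ := by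
      intro e he
      induction e with
      | h a b =>
        have hne := hadj a b he
        rcases hlayer a with ha | ha <;> rcases hlayer b with hb | hb
        · exact absurd (ha.trans hb.symm) hne
        · exact ⟨a, b, rfl, ha, hb⟩
        · exact ⟨b, a, Sym2.eq_swap, hb, ha⟩
        · exact absurd (ha.trans hb.symm) hne
    intro e he f hf
    by_cases hef : e = f
    · subst hef
      exact iff_of_true (edgesCross_self _ _) (edgesCross_self _ _)
    obtain ⟨a, b, rfl, ha, hb⟩ := hor e he
    obtain ⟨c, d, rfl, hc, hd⟩ := hor f hf
    have hlow : ∀ u v w : V, (pos u).2 = y₀ → (pos v).2 = y₁ → (pos w).2 = y₀ → u ≠ w →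
        orient (pos u) (pos v) (pos w) ≠ 0 := by
      intro u v w hu hv hw huw
      rw [orient_of_snd_eq (hu.trans hw.symm), hu, hv]
      refine neg_ne_zero.mpr (mul_ne_zero (sub_pos.mpr hy).ne' (sub_ne_zero.mpr fun h => ?_))
      exact huw (hpos (Prod.ext h.symm (hu.trans hw.symm)))
    have hupp : ∀ u v w : V, (pos u).2 = y₀ → (pos v).2 = y₁ → (pos w).2 = y₁ → v ≠ w →
        orient (pos u) (pos v) (pos w) ≠ 0 := by
      intro u v w hu hv hw hvw
      rw [orient_of_snd_eq' (hv.trans hw.symm), hu, hv]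
      refine mul_ne_zero (sub_pos.mpr hy).ne' (sub_ne_zero.mpr fun h => ?_)
      exact hvw (hpos (Prod.ext h (hv.trans hw.symm)))
    have hne : a ≠ c ∨ b ≠ d := by
      by_contra! h
      exact hef (by rw [h.1, h.2])
    refine edgesCross_iff_of_same_sign (hne.imp (hlow a b c ha hb hc) (hupp a b d ha hb hd))
      (hne.imp (fun h => hlow c d a hc hd ha h.symm) (fun h => hupp c d b hc hd hb h.symm)) h3
      ?_ ?_ ?_ ?_
    · exact or_iff_not_imp_left.mpr (hlow a b c ha hb hc)
    · exact or_iff_not_imp_left.mpr (hupp a b d ha hb hd)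
    · exact or_iff_not_imp_left.mpr fun h => hlow c d a hc hd ha (Ne.symm h)
    · exact or_iff_not_imp_left.mpr fun h => hupp c d b hc hd hb (Ne.symm h)

/-! ### Dense layered graphs -/

theorem eventually_quadratic_le {C : ℕ} {f : ℕ → ℕ}
    (hf : Asymptotics.IsLittleO Filter.atTop
      (fun n : ℕ => (n : ℝ) ^ 2 / Real.log n) (fun n : ℕ => (f n : ℝ))) {ε : ℝ} (hε : 0 < ε) :
    ∀ᶠ n : ℕ in Filter.atTop, ((C * (n ^ 2 + 1) : ℕ) : ℝ) ≤ ε * ((f n : ℝ) * Real.log n) := by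
  -- The 2 absorbs n² + 1 ≤ 2n², and C + 1 keeps the denominator positive when C = 0.
  have hc : 0 < ε / (2 * (C + 1)) := by positivity
  filter_upwards [hf.bound hc, Filter.eventually_ge_atTop 2] with n hn h2
  have hlog : 0 < Real.log n := Real.log_pos (by exact_mod_cast h2)
  have h2' : (2 : ℝ) ≤ n := by exact_mod_cast h2
  rw [Real.norm_of_nonneg (by positivity), Real.norm_of_nonneg (by positivity),
    div_le_iff₀ hlog] at hn
  have hn1 : (n : ℝ) ^ 2 + 1 ≤ 2 * n ^ 2 := by nlinarith
  push_cast
  calc (C : ℝ) * ((n : ℝ) ^ 2 + 1) ≤ (C + 1) * (2 * n ^ 2) := by gcongr; linarith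
    _ ≤ (C + 1) * (2 * (ε / (2 * (C + 1)) * f n * Real.log n)) := by gcongr
    _ = ε * (f n * Real.log n) := by field_simp

theorem mainTheorem3 :
    -- convex geometric graphs: the number of crossings is computed in `O(n ^ 2)` time
    (∃ (P : RamProgram) (C k : ℕ), ∀ (n : ℕ) (G : SimpleGraph (Fin n)) (pos : Fin n → ℝ × ℝ),
      ConvexIndependent ℝ pos →
        ∃ t : ℕ, t ≤ C * (n ^ 2 + 1) ∧ CountsCrossingsIn P k G pos t) ∧
    -- two opposite open rays at each vertex avoid the convex hull; they meet no edges
    (∀ (n : ℕ) (G : SimpleGraph (Fin n)) (pos : Fin n → ℝ × ℝ), ConvexIndependent ℝ pos →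
      ∀ u : Fin n, ∃ d : ℝ × ℝ, d ≠ 0 ∧
        Disjoint (openRay (pos u) d) (convexHull ℝ (Set.range pos)) ∧
        Disjoint (openRay (pos u) (-d)) (convexHull ℝ (Set.range pos)) ∧
        rayCount G pos (pos u) d = 0 ∧ rayCount G pos (pos u) (-d) = 0) ∧
    -- layered graphs: `O(n ^ 2)` time, hence `o(|E| log |V|)` if there are `ω(n ^ 2 / log n)` edges
    (∃ (P : RamProgram) (C k : ℕ),
      (∀ (n : ℕ) (G : SimpleGraph (Fin n)) (pos : Fin n → ℝ × ℝ), IsLayered G pos →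
        ∃ t : ℕ, t ≤ C * (n ^ 2 + 1) ∧ CountsCrossingsIn P k G pos t) ∧
      (∀ f : ℕ → ℕ,
        Asymptotics.IsLittleO Filter.atTop
          (fun n : ℕ => (n : ℝ) ^ 2 / Real.log n) (fun n : ℕ => (f n : ℝ)) →
        ∀ ε : ℝ, 0 < ε → ∀ᶠ n : ℕ in Filter.atTop,
          ∀ (G : SimpleGraph (Fin n)) (pos : Fin n → ℝ × ℝ), IsLayered G pos →
            f n ≤ G.edgeSet.ncard →
              ∃ t : ℕ, (t : ℝ) ≤ ε * ((G.edgeSet.ncard : ℝ) * Real.log n) ∧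
                CountsCrossingsIn P k G pos t)) ∧
    -- layered graphs: the crossings are those of the bilayer subgraphs, each of which becomes
    -- a convex geometric graph with the same crossing pairs under arbitrarily small perturbations
    (∀ (n : ℕ) (G : SimpleGraph (Fin n)) (pos : Fin n → ℝ × ℝ) (r : ℕ) (layer : Fin n → Fin r)
      (y : Fin r → ℝ), IsLayering G pos layer y →
        numCrossings G pos =
          ∑ i ∈ Finset.range (r - 1),
            numCrossings (bilayerGraph G layer i) (bilayerPos pos layer i) ∧
        ∀ i ∈ Finset.range (r - 1), ∀ ε : ℝ, 0 < ε →
          ∃ pos' : bilayer layer i → ℝ × ℝ, ConvexIndependent ℝ pos' ∧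
            (∀ v, dist (pos' v) (bilayerPos pos layer i v) < ε) ∧
            ∀ e ∈ (bilayerGraph G layer i).edgeSet, ∀ f ∈ (bilayerGraph G layer i).edgeSet,
              (EdgesCross pos' e f ↔ EdgesCross (bilayerPos pos layer i) e f)) := by
  refine ⟨⟨_, _, 5, fun n G pos h => convexProgram_counts G h⟩, ?_, ⟨_, _, 5,
    fun n G pos h => layeredProgram_counts h, ?_⟩, ?_⟩
  · intro n G pos h u
    obtain ⟨d, hd, h1, h2⟩ := h.exists_openRay_disjoint u
    exact ⟨d, hd, h1, h2, rayCount_eq_zero G h1, rayCount_eq_zero G h2⟩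
  · intro f hf ε hε
    filter_upwards [eventually_quadratic_le hf hε] with n hn G pos h hE
    obtain ⟨t, ht, hcount⟩ := layeredProgram_counts h
    refine ⟨t, ((Nat.cast_le.mpr ht).trans hn).trans ?_, hcount⟩
    have hlog : 0 ≤ Real.log n := Real.log_natCast_nonneg n
    gcongr
  · intro n G pos r layer y h
    refine ⟨h.numCrossings_eq_sum, ?_⟩
    intro i hi ε hε
    -- Even with truncated subtraction, this makes both i and i + 1 valid layer indices.
    have hi : i < r - 1 := Finset.mem_range.mp hi
    have hheight : ∀ v : bilayer layer i,
        ((layer v : ℕ) = i ∧ (bilayerPos pos layer i v).2 = y ⟨i, by omega⟩) ∨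
          ((layer v : ℕ) = i + 1 ∧ (bilayerPos pos layer i v).2 = y ⟨i + 1, by omega⟩) := by
      intro v
      refine v.2.imp (fun hv => ⟨hv, ?_⟩) (fun hv => ⟨hv, ?_⟩) <;>
      · rw [bilayerPos, h.height]
        congr 1
        exact Fin.ext hv
    have hy : y ⟨i, by omega⟩ < y ⟨i + 1, by omega⟩ := h.strictMono (by simp)
    refine exists_convex_perturbation (h.injective.comp Subtype.val_injective) hy
      (fun v => (hheight v).imp And.right And.right) (fun u v huv => ?_) hε
    change (pos u).2 ≠ (pos v).2
    rw [Ne, h.height_eq_iff]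
    have := h.adj u v huv
    omega
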